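/- Let $x$ be the affine coordinate of the (projective) circle, let $\theta$ be an odd variable, $\theta^2=0$, and let $C^\infty(S^{1|1})$ be the superalgebra of functions $F=f_0(x)+\theta f_1(x)$ with $f_0,f_1$ smooth real functions of $x\in\mathbb{R}$ ($f_0$ is even, $\theta f_1$ is odd, $p$ denotes the parity). Put $F'=\partial_x F$, $\eta=\partial_\theta+\theta\partial_x$, $\overline{\eta}=\partial_\theta-\theta\partial_x$ and $X_F=F\partial_x+\tfrac12\eta(F)\overline{\eta}$. Let $\mathfrak{osp}(1|2)=\mathrm{Span}(X_1,X_x,X_{x^2},X_{x\theta},X_\theta)$ with the superbracket of vector fields. For $\lambda,\mu\in\mathbb{R}$ let $\mathfrak{D}_{\lambda,\mu}$ be the space of differential operators $A=\sum_{i=0}^{\ell}a_i(x,\theta)\partial_x^i+\sum_{i=0}^{\ell}b_i(x,\theta)\partial_x^i\partial_\theta$, which map $\lambda$-densities to $\mu$-densities, with the action $$X_F\cdot A=\mathfrak{L}^{\mu}_{X_F}\circ A-(-1)^{p(A)p(F)}A\circ\mathfrak{L}^{\lambda}_{X_F},\qquad \mathfrak{L}^{\lambda}_{X_F}(G)=X_F(G)+\lambda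 F'G .$$ For $p\in\{0,1\}$ let $\mathrm{H}^1_p(\mathfrak{osp}(1|2);\mathfrak{D}_{\lambda,\mu})$ be the space of linear maps $c:\mathfrak{osp}(1|2)\to\mathfrak{D}_{\lambda,\mu}$ of parity $p$ with $c([X_F,X_G])=X_F\cdot c(X_G)-(-1)^{p(F)p(G)}X_G\cdot c(X_F)$ for homogeneous $F,G$ (the $1$-cocycles of parity $p$), modulo the maps $X_F\mapsto X_F\cdot A$ with $A\in\mathfrak{D}_{\lambda,\mu}$ of parity $p$. **Theorem.** The spaces $\mathrm{H}^1_p(\mathfrak{osp}(1|2);\mathfrak{D}_{\lambda,\mu})$ are finite dimensional, and: 1) $\mathrm{H}^1_0(\mathfrak{osp}(1|2);\mathfrak{D}_{\lambda,\mu})\simeq\mathbb{R}$ if $\lambda=\mu$, and it is $0$ otherwise. A basis of $\mathrm{H}^1_0(\mathfrak{osp}(1|2);\mathfrak{D}_{\lambda,\lambda})$ is given by the class of the $1$-cocycle $\Upsilon_{\lambda,\lambda}(X_F)=F'$ (multiplication by $F'$). 2) $\mathrm{H}^1_1(\mathfrak{osp}(1|2);\mathfrak{D}_{\lambda,\mu})\simeq\mathbb{R}^2$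 if $\lambda=\frac{1-k}{2}$, $\mu=\frac{k}{2}$ for some integer $k\geq1$, and it is $0$ otherwise. A basis of $\mathrm{H}^1_1(\mathfrak{osp}(1|2);\mathfrak{D}_{\frac{1-k}{2},\frac{k}{2}})$ is given by the classes of the $1$-cocycles $$\Upsilon_{\frac{1-k}{2},\frac{k}{2}}(X_F)=\overline{\eta}^2(F)\,\overline{\eta}^{2k-1},\qquad \widetilde{\Upsilon}_{\frac{1-k}{2},\frac{k}{2}}(X_F)=(k-1)\,\eta^4(F)\,\overline{\eta}^{2k-3}+\eta^3(F)\,\overline{\eta}^{2k-2},$$ where for $k=1$ the first term of $\widetilde{\Upsilon}$ is absent. -/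

import Mathlib

open scoped ContDiff

noncomputable section

namespace OspCohomology

/-- The sign `(-1)^p` of a parity `p ∈ ℤ/2`. -/
def sgn (p : ZMod 2) : ℝ := (-1) ^ p.val

@[simp] theorem sgn_zero : sgn 0 = 1 := by simp [sgn]

@[simp] theorem sgn_one : sgn 1 = -1 := by simp [sgn, ZMod.val_one]

theorem parity_cases (p : ZMod 2) : p = 0 ∨ p = 1 := by revert p; decide

@[simp] theorem two_eq_zero_parity : (1 + 1 : ZMod 2) = 0 := by decide

/-! ### Lie superalgebras and their first cohomology -/

/-- A real Lie superalgebra structure on a vector space `g = g₀ ⊕ g₁`. -/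
structure LieSuperalgebra (g : Type) [AddCommGroup g] [Module ℝ g] where
  /-- The homogeneous elements of a given parity. -/
  part : ZMod 2 → Submodule ℝ g
  isCompl : IsCompl (part 0) (part 1)
  /-- The superbracket. -/
  bracket : g →ₗ[ℝ] g →ₗ[ℝ] g
  bracket_mem : ∀ {p q : ZMod 2} {x y : g}, x ∈ part p → y ∈ part q →
    bracket x y ∈ part (p + q)
  bracket_skew : ∀ {p q : ZMod 2} {x y : g}, x ∈ part p → y ∈ part q →
    bracket x y = -(sgn (p * q) • bracket y x)
  jacobi : ∀ {p q r : ZMod 2} {x y z : g}, x ∈ part p → y ∈ part q → z ∈ part r →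
    bracket x (bracket y z) = bracket (bracket x y) z + sgn (p * q) • bracket y (bracket x z)

/-- A module `A = A₀ ⊕ A₁` over a Lie superalgebra. -/
structure SuperModule {g : Type} [AddCommGroup g] [Module ℝ g] (L : LieSuperalgebra g)
    (A : Type) [AddCommGroup A] [Module ℝ A] where
  /-- The homogeneous elements of a given parity. -/
  part : ZMod 2 → Submodule ℝ A
  isCompl : IsCompl (part 0) (part 1)
  /-- The action. -/
  act : g →ₗ[ℝ] A →ₗ[ℝ] A
  act_mem : ∀ {p q : ZMod 2} {x : g} {a : A}, x ∈ L.part p → a ∈ part q →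
    act x a ∈ part (p + q)
  act_bracket : ∀ {p q : ZMod 2} {x y : g}, x ∈ L.part p → y ∈ L.part q → ∀ a : A,
    act (L.bracket x y) a = act x (act y a) - sgn (p * q) • act y (act x a)

namespace SuperModule

variable {g A : Type} [AddCommGroup g] [Module ℝ g] [AddCommGroup A] [Module ℝ A]
  {L : LieSuperalgebra g} (M : SuperModule L A)

/-- One-cochains of parity `p`: linear maps that shift the parity by `p`. (Zero-cochains of parity
`p` are the elements of `M.part p`.) -/
def C1 (p : ZMod 2) : Submodule ℝ (g →ₗ[ℝ] A) where
  carrier := {c | ∀ q : ZMod 2, ∀ x ∈ L.part q, c x ∈ M.part (p + q)}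
  add_mem' := fun hc hd q x hx => (M.part (p + q)).add_mem (hc q x hx) (hd q x hx)
  zero_mem' := fun q _ _ => (M.part (p + q)).zero_mem
  smul_mem' := fun a _ hc q x hx => (M.part (p + q)).smul_mem a (hc q x hx)

/-- The coboundary of a zero-cochain: `(δ a)(x) = -x · a`. -/
def delta0 : A →ₗ[ℝ] (g →ₗ[ℝ] A) := -M.act.flip

/-- The coboundary of a one-cochain, on homogeneous elements of parities `q` and `r`:
`δc(x, y) = c([x, y]) - x · c(y) + (-1)^{qr} y · c(x)`. -/
def delta1 (c : g →ₗ[ℝ] A) (q r : ZMod 2) (x y : g) : A :=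
  c (L.bracket x y) - M.act x (c y) + sgn (q * r) • M.act y (c x)

/-- The one-cocycles of parity `p`. -/
def Z1 (p : ZMod 2) : Submodule ℝ (g →ₗ[ℝ] A) where
  carrier := {c | c ∈ M.C1 p ∧ ∀ q r : ZMod 2, ∀ x ∈ L.part q, ∀ y ∈ L.part r,
    M.delta1 c q r x y = 0}
  add_mem' := fun {c d} hc hd => ⟨(M.C1 p).add_mem hc.1 hd.1, fun q r x hx y hy => by
    have h : M.delta1 (c + d) q r x y = M.delta1 c q r x y + M.delta1 d q r x y := by
      simp only [delta1, LinearMap.add_apply, map_add, smul_add]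
      abel
    rw [h, hc.2 q r x hx y hy, hd.2 q r x hx y hy, add_zero]⟩
  zero_mem' := ⟨(M.C1 p).zero_mem, fun q r x _ y _ => by simp [delta1]⟩
  smul_mem' := fun a c hc => ⟨(M.C1 p).smul_mem a hc.1, fun q r x hx y hy => by
    have h : M.delta1 (a • c) q r x y = a • M.delta1 c q r x y := by
      simp only [delta1, LinearMap.smul_apply, map_smul, smul_add, smul_sub]
      rw [smul_comm a]
    rw [h, hc.2 q r x hx y hy, smul_zero]⟩

/-- The one-coboundaries of parity `p`: the image under `δ` of the zero-cochains of parity `p`. -/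
def B1 (p : ZMod 2) : Submodule ℝ (g →ₗ[ℝ] A) := (M.part p).map M.delta0

/-- Coboundaries are cocycles. -/
theorem B1_le_Z1 (p : ZMod 2) : M.B1 p ≤ M.Z1 p := by
  rintro _ ⟨a, ha, rfl⟩
  refine ⟨fun q x hx => ?_, fun q r x hx y hy => ?_⟩
  · have h := M.act_mem hx ha
    rw [add_comm] at h
    exact (M.part (p + q)).neg_mem h
  · simp only [delta1, delta0, LinearMap.neg_apply, LinearMap.flip_apply, map_neg,
      M.act_bracket hx hy, smul_neg]
    abel

/-- The parity `p` component of the first cohomology space, cocycles modulo coboundaries. -/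
abbrev H1 (p : ZMod 2) : Type := M.Z1 p ⧸ (M.B1 p).submoduleOf (M.Z1 p)

/-- The cohomology class of a cocycle. -/
def cohClass {p : ZMod 2} (c : g →ₗ[ℝ] A) (hc : c ∈ M.Z1 p) : M.H1 p :=
  Submodule.Quotient.mk ⟨c, hc⟩

end SuperModule

/-! ### Functions on the supercircle in the affine coordinate -/

/-- Smooth real functions of the (affine) even coordinate `x`, as a subalgebra. -/
def smoothSubalgebra : Subalgebra ℝ (ℝ → ℝ) where
  carrier := {f | ContDiff ℝ ∞ f}
  mul_mem' := fun {f g} (hf : ContDiff ℝ ∞ f) (hg : ContDiff ℝ ∞ g) => hf.mul hg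
  add_mem' := fun {f g} (hf : ContDiff ℝ ∞ f) (hg : ContDiff ℝ ∞ g) => hf.add hg
  algebraMap_mem' := fun c => (contDiff_const : ContDiff ℝ ∞ (fun _ : ℝ => c))

/-- The algebra of smooth real functions of the (affine) even coordinate `x`. -/
def SmoothFun : Type := smoothSubalgebra

instance : CommRing SmoothFun := inferInstanceAs (CommRing smoothSubalgebra)

instance : Algebra ℝ SmoothFun := inferInstanceAs (Algebra ℝ smoothSubalgebra)

/-- The underlying function. -/
def SmoothFun.toFun (f : SmoothFun) : ℝ → ℝ := f.1

@[simp] theorem SmoothFun.toFun_zero (x : ℝ) : (0 : SmoothFun).toFun x = 0 := rfl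
@[simp] theorem SmoothFun.toFun_one (x : ℝ) : (1 : SmoothFun).toFun x = 1 := rfl
@[simp] theorem SmoothFun.toFun_add (f g : SmoothFun) (x : ℝ) :
    (f + g).toFun x = f.toFun x + g.toFun x := rfl
@[simp] theorem SmoothFun.toFun_neg (f : SmoothFun) (x : ℝ) : (-f).toFun x = -f.toFun x := rfl
@[simp] theorem SmoothFun.toFun_sub (f g : SmoothFun) (x : ℝ) :
    (f - g).toFun x = f.toFun x - g.toFun x := rfl
@[simp] theorem SmoothFun.toFun_mul (f g : SmoothFun) (x : ℝ) :
    (f * g).toFun x = f.toFun x * g.toFun x := rfl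
@[simp] theorem SmoothFun.toFun_smul (c : ℝ) (f : SmoothFun) (x : ℝ) :
    (c • f).toFun x = c * f.toFun x := rfl

theorem SmoothFun.contDiff (f : SmoothFun) : ContDiff ℝ ∞ f.toFun := f.2

theorem SmoothFun.ext {f g : SmoothFun} (h : ∀ x, f.toFun x = g.toFun x) : f = g :=
  Subtype.ext (funext h)

theorem SmoothFun.differentiable (f : SmoothFun) : Differentiable ℝ f.toFun :=
  f.contDiff.differentiable (by simp)

/-- The derivative `f ↦ f'` on smooth functions, as a derivation. -/
def ddx : Derivation ℝ SmoothFun SmoothFun :=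
  Derivation.mk'
    { toFun := fun f => ⟨deriv f.toFun, (contDiff_infty_iff_deriv.1 f.contDiff).2⟩
      map_add' := fun f g => SmoothFun.ext fun x =>
        deriv_add (f.differentiable x) (g.differentiable x)
      map_smul' := fun c f => SmoothFun.ext fun x =>
        deriv_const_smul c (f.differentiable x) }
    (fun f g => SmoothFun.ext fun x => by
      refine (deriv_mul (f.differentiable x) (g.differentiable x)).trans ?_
      change _ = f.toFun x * deriv g.toFun x + g.toFun x * deriv f.toFun x
      ring)

/-- The coordinate function `x`. -/
def coordX : SmoothFun := ⟨fun x => x, (contDiff_id : ContDiff ℝ ∞ (id : ℝ → ℝ))⟩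

@[simp] theorem ddx_coordX : ddx coordX = 1 := SmoothFun.ext fun x => deriv_id x

/-- Superfunctions `F = f₀(x) + θ f₁(x)` with `θ² = 0`. Since there is only one odd variable, this
supercommutative algebra is the algebra of dual numbers over the smooth functions. -/
def SuperFun : Type := DualNumber SmoothFun

instance : CommRing SuperFun := inferInstanceAs (CommRing (DualNumber SmoothFun))

instance : Algebra ℝ SuperFun := inferInstanceAs (Algebra ℝ (DualNumber SmoothFun))

namespace SuperFun

/-- The superfunction `f₀ + θ f₁`. -/
def mk (f₀ f₁ : SmoothFun) : SuperFun :=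
  (TrivSqZeroExt.inl f₀ + TrivSqZeroExt.inr f₁ : DualNumber SmoothFun)

/-- The coefficient `f₀` of `F = f₀ + θ f₁`. -/
def fst (F : SuperFun) : SmoothFun := TrivSqZeroExt.fst F

/-- The coefficient `f₁` of `F = f₀ + θ f₁`. -/
def snd (F : SuperFun) : SmoothFun := TrivSqZeroExt.snd F

theorem ext {F G : SuperFun} (h₀ : F.fst = G.fst) (h₁ : F.snd = G.snd) : F = G :=
  TrivSqZeroExt.ext h₀ h₁

variable (F G : SuperFun) (c : ℝ) (f₀ f₁ : SmoothFun)

@[simp] theorem fst_mk : (mk f₀ f₁).fst = f₀ := add_zero f₀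
@[simp] theorem snd_mk : (mk f₀ f₁).snd = f₁ := zero_add f₁
@[simp] theorem fst_zero : (0 : SuperFun).fst = 0 := rfl
@[simp] theorem snd_zero : (0 : SuperFun).snd = 0 := rfl
@[simp] theorem fst_one : (1 : SuperFun).fst = 1 := rfl
@[simp] theorem snd_one : (1 : SuperFun).snd = 0 := rfl
@[simp] theorem fst_add : (F + G).fst = F.fst + G.fst := rfl
@[simp] theorem snd_add : (F + G).snd = F.snd + G.snd := rfl
@[simp] theorem fst_neg : (-F).fst = -F.fst := rfl
@[simp] theorem snd_neg : (-F).snd = -F.snd := rfl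
@[simp] theorem fst_sub : (F - G).fst = F.fst - G.fst := rfl
@[simp] theorem snd_sub : (F - G).snd = F.snd - G.snd := rfl
@[simp] theorem fst_smul : (c • F).fst = c • F.fst := rfl
@[simp] theorem snd_smul : (c • F).snd = c • F.snd := rfl
@[simp] theorem fst_mul : (F * G).fst = F.fst * G.fst := rfl
@[simp] theorem snd_mul : (F * G).snd = F.fst * G.snd + F.snd * G.fst := rfl

end SuperFun

/-- Linear operators on superfunctions. -/
abbrev Op : Type := Module.End ℝ SuperFun

/-- The even coordinate `x` as a superfunction. -/
def sx : SuperFun := SuperFun.mk coordX 0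

/-- The odd coordinate `θ`. -/
def sθ : SuperFun := SuperFun.mk 0 1

/-- The parity involution `f₀ + θ f₁ ↦ f₀ - θ f₁`. -/
def parity : Op where
  toFun F := SuperFun.mk F.fst (-F.snd)
  map_add' F G := by apply SuperFun.ext <;> simp [add_comm]
  map_smul' c F := by apply SuperFun.ext <;> simp

/-- `∂ₓ(f₀ + θ f₁) = f₀' + θ f₁'`. -/
def pdx : Op where
  toFun F := SuperFun.mk (ddx F.fst) (ddx F.snd)
  map_add' F G := by apply SuperFun.ext <;> simp
  map_smul' c F := by apply SuperFun.ext <;> simp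

/-- `∂_θ(f₀ + θ f₁) = f₁`. -/
def pdθ : Op where
  toFun F := SuperFun.mk F.snd 0
  map_add' F G := by apply SuperFun.ext <;> simp
  map_smul' c F := by apply SuperFun.ext <;> simp

/-- Multiplication by a superfunction, as an operator. -/
def mulOp : SuperFun →ₐ[ℝ] Op := Algebra.lmul ℝ SuperFun

/-- `η = ∂_θ + θ ∂ₓ`. -/
def eta : Op := pdθ + mulOp sθ * pdx

/-- `η̄ = ∂_θ - θ ∂ₓ`. -/
def etaBar : Op := pdθ - mulOp sθ * pdx

@[simp] theorem parity_fst (F : SuperFun) : (parity F).fst = F.fst := by simp [parity]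
@[simp] theorem parity_snd (F : SuperFun) : (parity F).snd = -F.snd := by simp [parity]
@[simp] theorem pdx_fst (F : SuperFun) : (pdx F).fst = ddx F.fst := by simp [pdx]
@[simp] theorem pdx_snd (F : SuperFun) : (pdx F).snd = ddx F.snd := by simp [pdx]
@[simp] theorem pdθ_fst (F : SuperFun) : (pdθ F).fst = F.snd := by simp [pdθ]
@[simp] theorem pdθ_snd (F : SuperFun) : (pdθ F).snd = 0 := by simp [pdθ]
@[simp] theorem mulOp_apply (F G : SuperFun) : mulOp F G = F * G := rfl
@[simp] theorem eta_fst (F : SuperFun) : (eta F).fst = F.snd := by simp [eta, sθ]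
@[simp] theorem eta_snd (F : SuperFun) : (eta F).snd = ddx F.fst := by simp [eta, sθ]
@[simp] theorem etaBar_fst (F : SuperFun) : (etaBar F).fst = F.snd := by simp [etaBar, sθ]
@[simp] theorem etaBar_snd (F : SuperFun) : (etaBar F).snd = -ddx F.fst := by simp [etaBar, sθ]

/-- Homogeneous superfunctions of parity `p`: functions `f₀(x)` are even, `θ f₁(x)` are odd. -/
def funPart (p : ZMod 2) : Submodule ℝ SuperFun where
  carrier := {F | (p = 0 → F.snd = 0) ∧ (p = 1 → F.fst = 0)}
  add_mem' := fun {F G} hF hG =>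
    ⟨fun h => by simp [hF.1 h, hG.1 h], fun h => by simp [hF.2 h, hG.2 h]⟩
  zero_mem' := by simp
  smul_mem' := fun c F hF => ⟨fun h => by simp [hF.1 h], fun h => by simp [hF.2 h]⟩

@[simp] theorem mem_funPart_zero (F : SuperFun) : F ∈ funPart 0 ↔ F.snd = 0 := by
  change ((0 : ZMod 2) = 0 → F.snd = 0) ∧ ((0 : ZMod 2) = 1 → F.fst = 0) ↔ _
  simp

@[simp] theorem mem_funPart_one (F : SuperFun) : F ∈ funPart 1 ↔ F.fst = 0 := by
  change ((1 : ZMod 2) = 0 → F.snd = 0) ∧ ((1 : ZMod 2) = 1 → F.fst = 0) ↔ _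
  simp

theorem eq_mk (F : SuperFun) : F = SuperFun.mk F.fst 0 + SuperFun.mk 0 F.snd := by
  apply SuperFun.ext <;> simp

theorem parity_of_mem {p : ZMod 2} {F : SuperFun} (hF : F ∈ funPart p) :
    parity F = sgn p • F := by
  rcases parity_cases p with rfl | rfl
  · rw [mem_funPart_zero] at hF
    apply SuperFun.ext <;> simp [hF]
  · rw [mem_funPart_one] at hF
    apply SuperFun.ext <;> simp [hF]

/-! ### Contact vector fields and `osp(1|2)` -/

/-- The contact vector field `X_F = F ∂ₓ + ½ η(F) (∂_θ - θ ∂ₓ)`, acting on superfunctions. -/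
def contactField : SuperFun →ₗ[ℝ] Op where
  toFun F := mulOp F * pdx + (1 / 2 : ℝ) • (mulOp (eta F) * etaBar)
  map_add' F G := by simp only [map_add, add_mul, smul_add]; abel
  map_smul' c F := by
    simp only [map_smul, smul_mul_assoc, RingHom.id_apply, smul_add]
    rw [smul_comm]

/-- The contact bracket `{F,G} = F G' - F' G + ½ (-1)^{p(F)+1} η̄(F) η̄(G)`; the sign, extended
linearly to all `F`, is the substitution of `-parity F` for `F`. -/
def contactBracket : SuperFun →ₗ[ℝ] SuperFun →ₗ[ℝ] SuperFun :=
  LinearMap.mk₂ ℝ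
    (fun F G => F * pdx G - pdx F * G - (1 / 2 : ℝ) • (etaBar (parity F) * etaBar G))
    (fun F F' G => by simp only [map_add, add_mul, smul_add]; abel)
    (fun c F G => by
      simp only [map_smul, smul_mul_assoc, smul_sub]
      rw [smul_comm c (1 / 2 : ℝ)])
    (fun F G G' => by simp only [map_add, mul_add, smul_add]; abel)
    (fun c F G => by
      simp only [map_smul, mul_smul_comm, smul_sub]
      rw [smul_comm c (1 / 2 : ℝ)])

theorem neg_one_smul_op (A : Op) : (-1 : ℝ) • A = -A :=
  LinearMap.ext fun F => neg_one_smul ℝ (A F)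

theorem contactField_fst (F G : SuperFun) : (contactField F G).fst =
    F.fst * ddx G.fst + (1 / 2 : ℝ) • (F.snd * G.snd) := by
  simp [contactField]

theorem contactField_snd (F G : SuperFun) : (contactField F G).snd =
    F.fst * ddx G.snd + (1 / 2 : ℝ) • (F.snd * ddx G.fst + ddx F.fst * G.snd) := by
  simp [contactField]
  refine SmoothFun.ext fun x => ?_
  simp
  ring

theorem contactBracket_fst (F G : SuperFun) : (contactBracket F G).fst =
    F.fst * ddx G.fst - ddx F.fst * G.fst + (1 / 2 : ℝ) • (F.snd * G.snd) := by
  simp [contactBracket]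

theorem contactBracket_snd (F G : SuperFun) : (contactBracket F G).snd =
    F.fst * ddx G.snd - ddx F.snd * G.fst
      + (1 / 2 : ℝ) • (F.snd * ddx G.fst - ddx F.fst * G.snd) := by
  simp [contactBracket]
  refine SmoothFun.ext fun x => ?_
  simp
  ring

theorem contactBracket_homogeneous {q : ZMod 2} {F : SuperFun} (hF : F ∈ funPart q)
    (G : SuperFun) :
    contactBracket F G =
      F * pdx G - pdx F * G + (1 / 2 * sgn (q + 1)) • (etaBar F * etaBar G) := by
  have h : sgn (q + 1) = -sgn q := by rcases parity_cases q with rfl | rfl <;> simp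
  simp only [contactBracket, LinearMap.mk₂_apply, parity_of_mem hF, h, map_smul, smul_mul_assoc,
    smul_smul, mul_neg, neg_smul, sub_eq_add_neg]

/-- A vector field `X_F` determines `F`. -/
theorem contactField_injective : Function.Injective contactField := by
  intro F G h
  have h1 := contactField_fst F sx
  have h2 := contactField_snd F sx
  rw [h, contactField_fst] at h1
  rw [h, contactField_snd] at h2
  simp [sx] at h1 h2
  exact SuperFun.ext h1.symm h2.symm

/-- `[X_F, X_G] = X_{F,G}` for the superbracket of vector fields. -/
theorem contactField_bracket {q r : ZMod 2} {F G : SuperFun} (hF : F ∈ funPart q)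
    (hG : G ∈ funPart r) :
    contactField (contactBracket F G) =
      contactField F * contactField G - sgn (q * r) • (contactField G * contactField F) := by
  apply LinearMap.ext
  intro K
  rcases parity_cases q with rfl | rfl <;> rcases parity_cases r with rfl | rfl <;>
    simp only [mem_funPart_zero, mem_funPart_one] at hF hG <;>
    apply SuperFun.ext <;>
    refine SmoothFun.ext fun x => ?_ <;>
    simp [contactField_fst, contactField_snd, contactBracket_fst, contactBracket_snd, hF, hG,
      Derivation.leibniz] <;>
    ring

theorem contactBracket_mem {p q : ZMod 2} {F G : SuperFun} (hF : F ∈ funPart p)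
    (hG : G ∈ funPart q) : contactBracket F G ∈ funPart (p + q) := by
  rcases parity_cases p with rfl | rfl <;> rcases parity_cases q with rfl | rfl <;>
    simp only [mem_funPart_zero, mem_funPart_one] at hF hG <;>
    simp [contactBracket_fst, contactBracket_snd, hF, hG]

theorem contactBracket_skew {p q : ZMod 2} {F G : SuperFun} (hF : F ∈ funPart p)
    (hG : G ∈ funPart q) : contactBracket F G = -(sgn (p * q) • contactBracket G F) := by
  apply contactField_injective
  rw [map_neg, map_smul, contactField_bracket hF hG, contactField_bracket hG hF, smul_sub,
    smul_smul]
  rcases parity_cases p with rfl | rfl <;> rcases parity_cases q with rfl | rfl <;>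
    simp [neg_one_smul_op]

theorem contactBracket_jacobi {p q r : ZMod 2} {F G K : SuperFun} (hF : F ∈ funPart p)
    (hG : G ∈ funPart q) (hK : K ∈ funPart r) :
    contactBracket F (contactBracket G K) =
      contactBracket (contactBracket F G) K
        + sgn (p * q) • contactBracket G (contactBracket F K) := by
  rcases parity_cases p with rfl | rfl <;> rcases parity_cases q with rfl | rfl <;>
    rcases parity_cases r with rfl | rfl <;>
    simp only [mem_funPart_zero, mem_funPart_one] at hF hG hK <;>
    apply SuperFun.ext <;>
    refine SmoothFun.ext fun x => ?_ <;>
    simp [contactBracket_fst, contactBracket_snd, hF, hG, hK, Derivation.leibniz] <;>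
    ring

/-- The space underlying `osp(1|2) = Span(X_1, X_x, X_{x²}, X_{xθ}, X_θ)`. A contact vector field
`X_F` is recorded by its function `F`, which it determines; the superbracket of vector fields is
then the contact bracket. -/
def osp12 : Submodule ℝ SuperFun := Submodule.span ℝ {1, sx, sx ^ 2, sx * sθ, sθ}

theorem mem_osp12_iff (F : SuperFun) : F ∈ osp12 ↔ ∃ a₀ a₁ a₂ b₁ b₀ : ℝ,
    F.fst = a₀ • 1 + a₁ • coordX + a₂ • (coordX * coordX) ∧ F.snd = b₁ • coordX + b₀ • 1 := by
  simp only [osp12, Submodule.mem_span_insert, Submodule.mem_span_singleton]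
  constructor
  · rintro ⟨a₀, _, ⟨a₁, _, ⟨a₂, _, ⟨b₁, _, ⟨b₀, rfl⟩, rfl⟩, rfl⟩, rfl⟩, rfl⟩
    refine ⟨a₀, a₁, a₂, b₁, b₀, ?_, ?_⟩ <;> simp [sx, sθ, sq, add_assoc]
  · rintro ⟨a₀, a₁, a₂, b₁, b₀, h0, h1⟩
    refine ⟨a₀, _, ⟨a₁, _, ⟨a₂, _, ⟨b₁, _, ⟨b₀, rfl⟩, rfl⟩, rfl⟩, rfl⟩, ?_⟩
    apply SuperFun.ext <;> simp [sx, sθ, sq, h0, h1, add_assoc]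

theorem contactBracket_mem_osp12 {F G : SuperFun} (hF : F ∈ osp12) (hG : G ∈ osp12) :
    contactBracket F G ∈ osp12 := by
  rw [mem_osp12_iff] at *
  obtain ⟨a₀, a₁, a₂, b₁, b₀, hF0, hF1⟩ := hF
  obtain ⟨c₀, c₁, c₂, d₁, d₀, hG0, hG1⟩ := hG
  refine ⟨a₀ * c₁ - a₁ * c₀ + b₀ * d₀ / 2, 2 * (a₀ * c₂ - a₂ * c₀) + (b₁ * d₀ + b₀ * d₁) / 2,
    a₁ * c₂ - a₂ * c₁ + b₁ * d₁ / 2, a₁ * d₁ / 2 - a₂ * d₀ - b₁ * c₁ / 2 + b₀ * c₂,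
    a₀ * d₁ - a₁ * d₀ / 2 + b₀ * c₁ / 2 - b₁ * c₀, ?_, ?_⟩
  · rw [contactBracket_fst, hF0, hF1, hG0, hG1]
    refine SmoothFun.ext fun x => ?_
    simp [Derivation.leibniz]
    ring
  · rw [contactBracket_snd, hF0, hF1, hG0, hG1]
    refine SmoothFun.ext fun x => ?_
    simp [Derivation.leibniz]
    ring

theorem isCompl_osp12 : IsCompl ((funPart 0).comap osp12.subtype)
    ((funPart 1).comap osp12.subtype) := by
  constructor
  · rw [Submodule.disjoint_def]
    intro F h0 h1
    simp only [Submodule.mem_comap, mem_funPart_zero, mem_funPart_one] at h0 h1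
    exact Subtype.ext (SuperFun.ext h1 h0)
  · rw [codisjoint_iff, Submodule.eq_top_iff']
    intro F
    obtain ⟨a₀, a₁, a₂, b₁, b₀, h0, h1⟩ := (mem_osp12_iff F).1 F.2
    rw [Submodule.mem_sup]
    refine ⟨⟨SuperFun.mk (F : SuperFun).fst 0, (mem_osp12_iff _).2
      ⟨a₀, a₁, a₂, 0, 0, by simpa using h0, by simp⟩⟩, by simp,
      ⟨SuperFun.mk 0 (F : SuperFun).snd, (mem_osp12_iff _).2
      ⟨0, 0, 0, b₁, b₀, by simp, by simpa using h1⟩⟩, by simp, ?_⟩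
    exact Subtype.ext (eq_mk _).symm

/-- The bracket of `osp(1|2)`. -/
def ospBracket : osp12 →ₗ[ℝ] osp12 →ₗ[ℝ] osp12 :=
  LinearMap.mk₂ ℝ (fun F G => ⟨contactBracket F G, contactBracket_mem_osp12 F.2 G.2⟩)
    (fun F F' G => Subtype.ext (by simp))
    (fun c F G => Subtype.ext (by simp))
    (fun F G G' => Subtype.ext (by simp))
    (fun c F G => Subtype.ext (by simp))

/-- The Lie superalgebra `osp(1|2)`. -/
def osp : LieSuperalgebra osp12 where
  part p := (funPart p).comap osp12.subtype
  isCompl := isCompl_osp12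
  bracket := ospBracket
  bracket_mem := fun hx hy => contactBracket_mem hx hy
  bracket_skew := fun hx hy => Subtype.ext (contactBracket_skew hx hy)
  jacobi := fun hx hy hz => Subtype.ext (contactBracket_jacobi hx hy hz)

/-! ### Differential operators and densities -/

/-- The differential operators `∑ aᵢ(x,θ) ∂ₓⁱ + ∑ bᵢ(x,θ) ∂ₓⁱ ∂_θ` (finite sums), as a space. -/
def diffOpSpan : Submodule ℝ Op :=
  Submodule.span ℝ
    {A | ∃ (a : SuperFun) (i : ℕ), A = mulOp a * pdx ^ i ∨ A = mulOp a * pdx ^ i * pdθ}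

theorem mulOp_mul_mem (F : SuperFun) {A : Op} (hA : A ∈ diffOpSpan) :
    mulOp F * A ∈ diffOpSpan := by
  induction hA using Submodule.span_induction with
  | mem A h =>
    obtain ⟨a, i, rfl | rfl⟩ := h
    · exact Submodule.subset_span ⟨F * a, i, Or.inl (by rw [map_mul, mul_assoc])⟩
    · exact Submodule.subset_span ⟨F * a, i, Or.inr (by simp only [map_mul, mul_assoc])⟩
  | zero => simp
  | add A B _ _ hA hB => rw [mul_add]; exact Submodule.add_mem _ hA hB
  | smul c A _ hA => rw [mul_smul_comm]; exact Submodule.smul_mem _ _ hA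

theorem pdx_mul_mulOp (a : SuperFun) : pdx * mulOp a = mulOp (pdx a) + mulOp a * pdx := by
  apply LinearMap.ext
  intro G
  apply SuperFun.ext <;> (simp [Derivation.leibniz]; ring)

theorem pdθ_mul_mulOp (a : SuperFun) :
    pdθ * mulOp a = mulOp (pdθ a) + mulOp (parity a) * pdθ := by
  apply LinearMap.ext
  intro G
  apply SuperFun.ext <;> simp <;> ring

theorem pdθ_mul_pdx : pdθ * pdx = pdx * pdθ := by
  apply LinearMap.ext
  intro G
  apply SuperFun.ext <;> simp

theorem pdθ_mul_pdθ : pdθ * pdθ = 0 := by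
  apply LinearMap.ext
  intro G
  apply SuperFun.ext <;> simp

theorem pdx_mul_mem {A : Op} (hA : A ∈ diffOpSpan) : pdx * A ∈ diffOpSpan := by
  induction hA using Submodule.span_induction with
  | mem A h =>
    obtain ⟨a, i, rfl | rfl⟩ := h
    · rw [← mul_assoc, pdx_mul_mulOp, add_mul, mul_assoc (mulOp a), ← pow_succ']
      exact Submodule.add_mem _ (Submodule.subset_span ⟨_, _, Or.inl rfl⟩)
        (Submodule.subset_span ⟨_, _, Or.inl rfl⟩)
    · rw [← mul_assoc, ← mul_assoc, pdx_mul_mulOp, add_mul, mul_assoc (mulOp a), ← pow_succ',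
        add_mul]
      exact Submodule.add_mem _ (Submodule.subset_span ⟨_, _, Or.inr rfl⟩)
        (Submodule.subset_span ⟨_, _, Or.inr rfl⟩)
  | zero => simp
  | add A B _ _ hA hB => rw [mul_add]; exact Submodule.add_mem _ hA hB
  | smul c A _ hA => rw [mul_smul_comm]; exact Submodule.smul_mem _ _ hA

theorem pdθ_mul_mem {A : Op} (hA : A ∈ diffOpSpan) : pdθ * A ∈ diffOpSpan := by
  have hc : ∀ i : ℕ, pdθ * pdx ^ i = pdx ^ i * pdθ := fun i =>
    ((show Commute pdθ pdx from pdθ_mul_pdx).pow_right i)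
  induction hA using Submodule.span_induction with
  | mem A h =>
    obtain ⟨a, i, rfl | rfl⟩ := h
    · rw [← mul_assoc, pdθ_mul_mulOp, add_mul, mul_assoc (mulOp (parity a)), hc, ← mul_assoc]
      exact Submodule.add_mem _ (Submodule.subset_span ⟨_, _, Or.inl rfl⟩)
        (Submodule.subset_span ⟨_, _, Or.inr rfl⟩)
    · rw [← mul_assoc, ← mul_assoc, pdθ_mul_mulOp, add_mul, mul_assoc (mulOp (parity a)), hc,
        add_mul, mul_assoc (mulOp (parity a)), mul_assoc (pdx ^ i), pdθ_mul_pdθ, mul_zero,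
        mul_zero, add_zero]
      exact Submodule.subset_span ⟨_, _, Or.inr rfl⟩
  | zero => simp
  | add A B _ _ hA hB => rw [mul_add]; exact Submodule.add_mem _ hA hB
  | smul c A _ hA => rw [mul_smul_comm]; exact Submodule.smul_mem _ _ hA

theorem one_mem_diffOpSpan : (1 : Op) ∈ diffOpSpan :=
  Submodule.subset_span ⟨1, 0, Or.inl (by simp)⟩

theorem mul_mem_diffOpSpan {A B : Op} (hA : A ∈ diffOpSpan) (hB : B ∈ diffOpSpan) :
    A * B ∈ diffOpSpan := by
  have hp : ∀ i : ℕ, ∀ B ∈ diffOpSpan, pdx ^ i * B ∈ diffOpSpan := by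
    intro i
    induction i with
    | zero => intro B hB; simpa using hB
    | succ i ih => intro B hB; rw [pow_succ, mul_assoc]; exact ih _ (pdx_mul_mem hB)
  induction hA using Submodule.span_induction with
  | mem A h =>
    obtain ⟨a, i, rfl | rfl⟩ := h
    · rw [mul_assoc]
      exact mulOp_mul_mem a (hp i B hB)
    · rw [mul_assoc, mul_assoc]
      exact mulOp_mul_mem a (hp i _ (pdθ_mul_mem hB))
  | zero => simp
  | add A B _ _ hA hB => rw [add_mul]; exact Submodule.add_mem _ hA hB
  | smul c A _ hA => rw [smul_mul_assoc]; exact Submodule.smul_mem _ _ hA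

/-- The differential operators form a subalgebra of all linear operators. -/
def diffOpAlg : Subalgebra ℝ Op :=
  diffOpSpan.toSubalgebra one_mem_diffOpSpan (fun _ _ hA hB => mul_mem_diffOpSpan hA hB)

theorem mulOp_mem (F : SuperFun) : mulOp F ∈ diffOpAlg :=
  Submodule.subset_span ⟨F, 0, Or.inl (by simp)⟩

theorem pdx_mem : pdx ∈ diffOpAlg :=
  Submodule.subset_span ⟨1, 1, Or.inl (by simp)⟩

theorem pdθ_mem : pdθ ∈ diffOpAlg :=
  Submodule.subset_span ⟨1, 0, Or.inr (by simp)⟩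

theorem parity_eq : parity = 1 - (2 : ℝ) • (mulOp sθ * pdθ) := by
  apply LinearMap.ext
  intro G
  apply SuperFun.ext
  · simp [sθ]
  · refine SmoothFun.ext fun x => ?_
    simp [sθ]
    ring

theorem parity_mem : parity ∈ diffOpAlg := by
  rw [parity_eq]
  exact diffOpAlg.sub_mem diffOpAlg.one_mem
    (diffOpAlg.smul_mem (diffOpAlg.mul_mem (mulOp_mem _) pdθ_mem) _)

/-- The algebra of differential operators; for all `λ`, `μ` it is the space underlying
`𝔇_{λ,μ}`. -/
def DiffOp : Type := diffOpAlg

instance : Ring DiffOp := inferInstanceAs (Ring diffOpAlg)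

instance : Algebra ℝ DiffOp := inferInstanceAs (Algebra ℝ diffOpAlg)

/-- The linear operator given by a differential operator. -/
def toOp : DiffOp →ₐ[ℝ] Op := diffOpAlg.val

theorem toOp_injective : Function.Injective toOp := Subtype.val_injective

theorem etaBar_mem : etaBar ∈ diffOpAlg :=
  diffOpAlg.sub_mem pdθ_mem (diffOpAlg.mul_mem (mulOp_mem _) pdx_mem)

/-- Multiplication by a superfunction as a differential operator. -/
def dmul : SuperFun →ₗ[ℝ] DiffOp where
  toFun F := ⟨mulOp F, mulOp_mem F⟩
  map_add' F G := Subtype.ext (map_add mulOp F G)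
  map_smul' c F := Subtype.ext (map_smul mulOp c F)

/-- `η̄` as a differential operator. -/
def dEtaBar : DiffOp := ⟨etaBar, etaBar_mem⟩

/-- The parity involution as a differential operator. -/
def dParity : DiffOp := ⟨parity, parity_mem⟩

/-- Homogeneous differential operators of parity `p`: those that map superfunctions of parity `q`
to superfunctions of parity `p + q`. -/
def opPart (p : ZMod 2) : Submodule ℝ DiffOp where
  carrier := {A | ∀ q : ZMod 2, ∀ F ∈ funPart q, toOp A F ∈ funPart (p + q)}
  add_mem' := fun hA hB q F hF => (funPart (p + q)).add_mem (hA q F hF) (hB q F hF)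
  zero_mem' := fun q _ _ => (funPart (p + q)).zero_mem
  smul_mem' := fun c _ hA q F hF => (funPart (p + q)).smul_mem c (hA q F hF)

@[simp] theorem toOp_dmul (F : SuperFun) : toOp (dmul F) = mulOp F := rfl

@[simp] theorem toOp_dParity : toOp dParity = parity := rfl

theorem dParity_mul_dParity : dParity * dParity = 1 := by
  apply toOp_injective
  apply LinearMap.ext
  intro F
  apply SuperFun.ext <;> simp

theorem mem_opPart_iff (p : ZMod 2) (A : DiffOp) :
    A ∈ opPart p ↔ dParity * A * dParity = sgn p • A := by
  have hs : sgn p * sgn p = 1 := by rcases parity_cases p with rfl | rfl <;> simp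
  constructor
  · intro h
    apply toOp_injective
    apply LinearMap.ext
    intro F
    have h0 : ∀ q : ZMod 2, ∀ G ∈ funPart q,
        toOp (dParity * A * dParity) G = toOp (sgn p • A) G := by
      intro q G hG
      have h1 := parity_of_mem (h q G hG)
      simp only [map_mul, toOp_dParity, Module.End.mul_apply, map_smul, LinearMap.smul_apply,
        parity_of_mem hG, h1, smul_smul]
      rcases parity_cases p with rfl | rfl <;> rcases parity_cases q with rfl | rfl <;> simp
    rw [eq_mk F, map_add, map_add, h0 0 _ (by simp), h0 1 _ (by simp)]
  · intro h q F hF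
    have h1 : parity (toOp A (parity F)) = sgn p • toOp A F := by
      have := congrArg (fun B : DiffOp => toOp B F) h
      simpa only [map_mul, toOp_dParity, Module.End.mul_apply, map_smul,
        LinearMap.smul_apply] using this
    rw [parity_of_mem hF, map_smul, map_smul] at h1
    have e0 := congrArg SuperFun.fst h1
    have e1 := congrArg SuperFun.snd h1
    have key : ∀ f : SmoothFun, f = -f → f = 0 := by
      intro f hf
      refine SmoothFun.ext fun x => ?_
      have := congrArg (fun g : SmoothFun => g.toFun x) hf
      simp only [SmoothFun.toFun_neg] at this
      rw [SmoothFun.toFun_zero]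
      linarith
    rcases parity_cases p with rfl | rfl <;> rcases parity_cases q with rfl | rfl <;>
      simp only [sgn_zero, sgn_one, one_smul, neg_smul, SuperFun.fst_neg,
        SuperFun.snd_neg, parity_fst, parity_snd, neg_neg, add_zero, zero_add,
        two_eq_zero_parity, mem_funPart_zero, mem_funPart_one] at e0 e1 ⊢
    · exact key _ e1.symm
    · exact key _ e0.symm
    · exact key _ e0
    · exact key _ e1

theorem isCompl_opPart : IsCompl (opPart 0) (opPart 1) := by
  constructor
  · rw [Submodule.disjoint_def]
    intro A h0 h1
    rw [mem_opPart_iff] at h0 h1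
    rw [h0] at h1
    have h2 : (2 : ℝ) • A = 0 := by
      rw [two_smul]
      nth_rewrite 1 [← one_smul ℝ A]
      rw [← sgn_zero, h1]
      simp
    exact (smul_eq_zero.1 h2).resolve_left two_ne_zero
  · rw [codisjoint_iff, Submodule.eq_top_iff']
    intro A
    have hP : ∀ B : DiffOp, dParity * (dParity * B * dParity) * dParity = B := by
      intro B
      calc dParity * (dParity * B * dParity) * dParity
          = (dParity * dParity) * B * (dParity * dParity) := by noncomm_ring
        _ = B := by rw [dParity_mul_dParity, one_mul, mul_one]
    rw [Submodule.mem_sup]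
    refine ⟨(1 / 2 : ℝ) • (A + dParity * A * dParity), ?_,
      (1 / 2 : ℝ) • (A - dParity * A * dParity), ?_, ?_⟩
    · rw [mem_opPart_iff, mul_smul_comm, smul_mul_assoc, mul_add, add_mul, hP]
      simp [add_comm]
    · rw [mem_opPart_iff, mul_smul_comm, smul_mul_assoc, mul_sub, sub_mul, hP]
      simp [← smul_neg]
    · rw [← smul_add]
      have : A + dParity * A * dParity + (A - dParity * A * dParity) = (2 : ℝ) • A := by
        rw [two_smul]; abel
      rw [this, smul_smul]
      norm_num

theorem opPart_mul_mem {p q : ZMod 2} {A B : DiffOp} (hA : A ∈ opPart p) (hB : B ∈ opPart q) :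
    A * B ∈ opPart (p + q) := by
  intro r F hF
  have h := hA _ _ (hB r F hF)
  rw [← add_assoc] at h
  exact h

theorem contactField_mem (F : SuperFun) : contactField F ∈ diffOpAlg :=
  diffOpAlg.add_mem (diffOpAlg.mul_mem (mulOp_mem _) pdx_mem)
    (diffOpAlg.smul_mem (diffOpAlg.mul_mem (mulOp_mem _) etaBar_mem) _)

/-- The contact vector field as a differential operator. -/
def dContact : SuperFun →ₗ[ℝ] DiffOp where
  toFun F := ⟨contactField F, contactField_mem F⟩
  map_add' F G := Subtype.ext (map_add contactField F G)
  map_smul' c F := Subtype.ext (map_smul contactField c F)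

/-- The Lie derivative `𝔏^λ_{X_F} = X_F + λ F'` of `λ`-densities. -/
def lieDensity (lam : ℝ) : SuperFun →ₗ[ℝ] DiffOp := dContact + lam • (dmul ∘ₗ pdx)

theorem lieDensity_fst (lam : ℝ) (F G : SuperFun) : (toOp (lieDensity lam F) G).fst =
    F.fst * ddx G.fst + (1 / 2 : ℝ) • (F.snd * G.snd) + lam • (ddx F.fst * G.fst) := by
  have h : toOp (lieDensity lam F) G = contactField F G + lam • (pdx F * G) := rfl
  rw [h, SuperFun.fst_add, contactField_fst]
  simp

theorem lieDensity_snd (lam : ℝ) (F G : SuperFun) : (toOp (lieDensity lam F) G).snd =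
    F.fst * ddx G.snd + (1 / 2 : ℝ) • (F.snd * ddx G.fst + ddx F.fst * G.snd)
      + lam • (ddx F.fst * G.snd + ddx F.snd * G.fst) := by
  have h : toOp (lieDensity lam F) G = contactField F G + lam • (pdx F * G) := rfl
  rw [h, SuperFun.snd_add, contactField_snd]
  simp

theorem lieDensity_mem (lam : ℝ) {p : ZMod 2} {F : SuperFun} (hF : F ∈ funPart p) :
    lieDensity lam F ∈ opPart p := by
  intro q G hG
  rcases parity_cases p with rfl | rfl <;> rcases parity_cases q with rfl | rfl <;>
    simp only [mem_funPart_zero, mem_funPart_one] at hF hG <;>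
    simp [lieDensity_fst, lieDensity_snd, hF, hG]

/-- The `λ`-densities form a module over the contact vector fields. -/
theorem lieDensity_bracket (lam : ℝ) {q r : ZMod 2} {F G : SuperFun} (hF : F ∈ funPart q)
    (hG : G ∈ funPart r) :
    lieDensity lam (contactBracket F G) =
      lieDensity lam F * lieDensity lam G
        - sgn (q * r) • (lieDensity lam G * lieDensity lam F) := by
  apply toOp_injective
  apply LinearMap.ext
  intro K
  rcases parity_cases q with rfl | rfl <;> rcases parity_cases r with rfl | rfl <;>
    simp only [mem_funPart_zero, mem_funPart_one] at hF hG <;>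
    apply SuperFun.ext <;>
    refine SmoothFun.ext fun x => ?_ <;>
    simp [lieDensity_fst, lieDensity_snd, contactBracket_fst, contactBracket_snd, hF, hG,
      Derivation.leibniz] <;>
    ring

/-- The even part `f₀` of a superfunction. -/
def evenPart : SuperFun →ₗ[ℝ] SuperFun := (1 / 2 : ℝ) • (1 + parity)

/-- The odd part `θ f₁` of a superfunction. -/
def oddPart : SuperFun →ₗ[ℝ] SuperFun := (1 / 2 : ℝ) • (1 - parity)

/-- The action `𝔏^{λ,μ}_{X_F}(A) = 𝔏^μ_{X_F} ∘ A - (-1)^{p(A)p(F)} A ∘ 𝔏^λ_{X_F}` on the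
differential operators from `λ`-densities to `μ`-densities, extended bilinearly from homogeneous
`F` and `A`: for odd `F` the sign `(-1)^{p(A)}` turns `A` into `parity ∘ A ∘ parity`. -/
def lieDiff (lam mu : ℝ) : SuperFun →ₗ[ℝ] DiffOp →ₗ[ℝ] DiffOp :=
  LinearMap.mk₂ ℝ
    (fun F A => lieDensity mu F * A
      - (A * lieDensity lam (evenPart F) + dParity * A * dParity * lieDensity lam (oddPart F)))
    (fun F G A => by simp only [map_add, add_mul, mul_add]; abel)
    (fun c F A => by simp only [map_smul, smul_mul_assoc, mul_smul_comm, smul_sub, smul_add])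
    (fun F A B => by simp only [add_mul, mul_add]; abel)
    (fun c F A => by simp only [smul_mul_assoc, mul_smul_comm, smul_sub, smul_add])

theorem evenPart_add_oddPart_of_mem {q : ZMod 2} {F : SuperFun} (hF : F ∈ funPart q) :
    (q = 0 → evenPart F = F ∧ oddPart F = 0) ∧ (q = 1 → evenPart F = 0 ∧ oddPart F = F) := by
  have h2 : (1 / 2 : ℝ) • ((2 : ℝ) • F) = F := by rw [smul_smul]; norm_num
  have h := parity_of_mem hF
  constructor <;> rintro rfl
  · simp only [sgn_zero, one_smul] at h
    simp only [evenPart, oddPart, LinearMap.smul_apply, LinearMap.add_apply, LinearMap.sub_apply,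
      Module.End.one_apply, h, sub_self, smul_zero, and_true, ← two_smul ℝ F, h2]
  · simp only [sgn_one, neg_smul, one_smul] at h
    simp only [evenPart, oddPart, LinearMap.smul_apply, LinearMap.add_apply, LinearMap.sub_apply,
      Module.End.one_apply, h, add_neg_cancel, sub_neg_eq_add, smul_zero, true_and,
      ← two_smul ℝ F, h2]

theorem lieDiff_homogeneous (lam mu : ℝ) {p q : ZMod 2} {F : SuperFun} {A : DiffOp}
    (hF : F ∈ funPart q) (hA : A ∈ opPart p) :
    lieDiff lam mu F A = lieDensity mu F * A - sgn (p * q) • (A * lieDensity lam F) := by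
  have h := evenPart_add_oddPart_of_mem hF
  rw [mem_opPart_iff] at hA
  simp only [lieDiff, LinearMap.mk₂_apply, hA]
  rcases parity_cases q with rfl | rfl
  · rw [(h.1 rfl).1, (h.1 rfl).2]
    simp
  · rw [(h.2 rfl).1, (h.2 rfl).2]
    simp

theorem lieDiff_mem (lam mu : ℝ) {p q : ZMod 2} {F : SuperFun} {A : DiffOp}
    (hF : F ∈ funPart p) (hA : A ∈ opPart q) : lieDiff lam mu F A ∈ opPart (p + q) := by
  rw [lieDiff_homogeneous lam mu hF hA]
  refine Submodule.sub_mem _ (opPart_mul_mem (lieDensity_mem mu hF) hA)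
    (Submodule.smul_mem _ _ ?_)
  rw [add_comm]
  exact opPart_mul_mem hA (lieDensity_mem lam hF)

theorem lieDiff_bracket (lam mu : ℝ) {p q : ZMod 2} {F G : SuperFun} (hF : F ∈ funPart p)
    (hG : G ∈ funPart q) (A : DiffOp) :
    lieDiff lam mu (contactBracket F G) A =
      lieDiff lam mu F (lieDiff lam mu G A)
        - sgn (p * q) • lieDiff lam mu G (lieDiff lam mu F A) := by
  have key : ∀ r : ZMod 2, ∀ A ∈ opPart r, lieDiff lam mu (contactBracket F G) A =
      lieDiff lam mu F (lieDiff lam mu G A)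
        - sgn (p * q) • lieDiff lam mu G (lieDiff lam mu F A) := by
    intro r A hA
    rw [lieDiff_homogeneous lam mu (contactBracket_mem hF hG) hA,
      lieDiff_homogeneous lam mu hF (lieDiff_mem lam mu hG hA),
      lieDiff_homogeneous lam mu hG (lieDiff_mem lam mu hF hA),
      lieDiff_homogeneous lam mu hF hA, lieDiff_homogeneous lam mu hG hA,
      lieDensity_bracket mu hF hG, lieDensity_bracket lam hF hG]
    rcases parity_cases p with rfl | rfl <;> rcases parity_cases q with rfl | rfl <;>
      rcases parity_cases r with rfl | rfl <;> simp <;> noncomm_ring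
  have hA : A ∈ opPart 0 ⊔ opPart 1 := by
    rw [isCompl_opPart.sup_eq_top]
    exact Submodule.mem_top
  obtain ⟨B, hB, C, hC, rfl⟩ := Submodule.mem_sup.1 hA
  simp only [map_add, key 0 B hB, key 1 C hC, smul_add]
  abel

/-- The `osp(1|2)`-module `𝔇_{λ,μ}` of differential operators from `λ`-densities to
`μ`-densities. -/
def diffOpModule (lam mu : ℝ) : SuperModule osp DiffOp where
  part := opPart
  isCompl := isCompl_opPart
  act := lieDiff lam mu ∘ₗ osp12.subtype
  act_mem := fun hx ha => lieDiff_mem lam mu hx ha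
  act_bracket := fun hx hy a => lieDiff_bracket lam mu hx hy a

/-! ### The explicit cochains -/

/-- `Υ(X_F) = F'`. -/
def upsilonEven : osp12 →ₗ[ℝ] DiffOp := dmul ∘ₗ pdx ∘ₗ osp12.subtype

/-- `Υ(X_F) = η̄²(F) η̄^{2k-1}`, for `k ≥ 1`. -/
def upsilonOdd (k : ℕ) : osp12 →ₗ[ℝ] DiffOp :=
  LinearMap.mulRight ℝ (dEtaBar ^ (2 * k - 1)) ∘ₗ dmul ∘ₗ (etaBar ^ 2 : Op) ∘ₗ osp12.subtype

/-- `Υ̃(X_F) = (k-1) η⁴(F) η̄^{2k-3} + η³(F) η̄^{2k-2}`, for `k ≥ 1`. For `k = 1` the first term is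
absent, because of the factor `k - 1 = 0`. -/
def upsilonOddTilde (k : ℕ) : osp12 →ₗ[ℝ] DiffOp :=
  ((k : ℝ) - 1) •
      (LinearMap.mulRight ℝ (dEtaBar ^ (2 * k - 3)) ∘ₗ dmul ∘ₗ (eta ^ 4 : Op) ∘ₗ osp12.subtype)
    + LinearMap.mulRight ℝ (dEtaBar ^ (2 * k - 2)) ∘ₗ dmul ∘ₗ (eta ^ 3 : Op) ∘ₗ osp12.subtype

end OspCohomology

end

open OspCohomology

noncomputable section

namespace OspCohomology

/-! ### Symbols of differential operators with respect to `η̄` -/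

/-! Since `η̄² = -∂ₓ`, every differential operator has a unique expansion `∑ aⱼ η̄ʲ` with
superfunction coefficients (`ofSymbol_injective`, `ofSymbol_surjective`). The field `η` anticommutes
with `η̄`, and `X_θ` acts on densities as `½η`, so its action on an operator is `½η` applied to each
coefficient (`lieDiff_sθ`). This action is onto, and its kernel consists of the operators with
constant coefficients, on which `X_x` is diagonal: `η̄ʲ` has weight `μ - λ - j/2`.

The odd fields `X_θ` and `X_{xθ}` generate `osp(1|2)`, so a cocycle is determined by its values
there (`cocycle_eq_zero`). Subtracting a coboundary gives `c(X_θ) = 0`. Then `c(X_x)` is killed by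
`X_θ`, hence has constant coefficients, and a second coboundary reduces it to its weight zero part
`β`. The remaining cocycle conditions give `c(X_{xθ}) = θβ + γ` with `γ` constant, together with one
equation relating `β` and `γ` through the action of `X_{xθ}` (`exists_normal_form`).

At most one power `η̄ⁿ` has weight zero, and if none does, the equation kills everything. If `n =
0`, then `λ = μ`, `γ = 0`, and `β` is a multiple of `1`: this is the class of `F'`. If `n ≥ 1`, then
`γ` is a multiple of `η̄ⁿ⁻¹`, and `X_{xθ} · η̄ⁿ = q η̄ⁿ⁻¹` for an explicit scalar `q`
(`lieDiff_sx_mul_sθ_pow`). When `q ≠ 0`, the equation forces `β = 0`, and `γ` is removed by the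
coboundary of a multiple of `η̄ⁿ`. When `q = 0`, necessarily `n = 2k - 1`, `λ = (1-k)/2`, `μ = k/2`,
and both parameters survive.

In this exceptional case `Y = η̄²ᵏ⁻¹` is invariant (`isInvariant_pow`), so composing the cocycle
`F'` with `Y` on either side again gives a cocycle. Up to sign, `Υ` is the right composition, and
`Υ̃` is the difference of the two (`upsilonOddTilde_eq`). The classification treats even and odd
cochains together; parities are separated at the end by `mem_B1_of_sub_mem_C1`. -/

theorem ddx_surjective : Function.Surjective ddx := by
  intro f
  have hc : Continuous f.toFun := f.contDiff.continuous
  have hd : ∀ x, HasDerivAt (fun u => ∫ t in (0 : ℝ)..u, f.toFun t) (f.toFun x) x := fun x =>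
    intervalIntegral.integral_hasDerivAt_right (hc.intervalIntegrable _ _)
      (hc.stronglyMeasurableAtFilter _ _) hc.continuousAt
  have hderiv : deriv (fun u => ∫ t in (0 : ℝ)..u, f.toFun t) = f.toFun :=
    funext fun x => (hd x).deriv
  refine ⟨⟨fun u => ∫ t in (0 : ℝ)..u, f.toFun t, ?_⟩, SmoothFun.ext fun x => (hd x).deriv⟩
  change ContDiff ℝ ∞ _
  rw [contDiff_infty_iff_deriv, hderiv]
  exact ⟨fun x => (hd x).differentiableAt, f.contDiff⟩

theorem exists_eq_smul_one_of_ddx_eq_zero {f : SmoothFun} (h : ddx f = 0) :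
    ∃ c : ℝ, f = c • 1 := by
  refine ⟨f.toFun 0, SmoothFun.ext fun x => ?_⟩
  have h' : ∀ x, deriv f.toFun x = 0 := fun x => congrArg (fun g : SmoothFun => g.toFun x) h
  simp [is_const_of_deriv_eq_zero f.differentiable h' x 0]

theorem eta_surjective : Function.Surjective eta := by
  intro F
  obtain ⟨f, hf⟩ := ddx_surjective F.snd
  exact ⟨SuperFun.mk f F.fst, by apply SuperFun.ext <;> simp [hf]⟩

theorem etaBar_surjective : Function.Surjective etaBar := by
  intro F
  obtain ⟨f, hf⟩ := ddx_surjective (-F.snd)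
  exact ⟨SuperFun.mk f F.fst, by apply SuperFun.ext <;> simp [hf]⟩

theorem exists_eq_smul_one_of_eta_eq_zero {F : SuperFun} (h : eta F = 0) :
    ∃ c : ℝ, F = c • 1 := by
  have h0 := congrArg SuperFun.fst h
  have h1 := congrArg SuperFun.snd h
  simp only [eta_fst, eta_snd, SuperFun.fst_zero, SuperFun.snd_zero] at h0 h1
  obtain ⟨c, hc⟩ := exists_eq_smul_one_of_ddx_eq_zero h1
  exact ⟨c, by apply SuperFun.ext <;> simp [h0, hc]⟩

theorem DiffOp.ext_apply {A B : DiffOp} (h : ∀ F, toOp A F = toOp B F) : A = B :=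
  toOp_injective (LinearMap.ext h)

@[simp] theorem toOp_dEtaBar : toOp dEtaBar = etaBar := rfl

@[simp] theorem dmul_one : dmul 1 = 1 := DiffOp.ext_apply fun F => by simp

theorem dmul_mul (F G : SuperFun) : dmul (F * G) = dmul F * dmul G :=
  DiffOp.ext_apply fun K => by simp

/-- A finitely supported family of coefficients `a` yields the operator `∑ aⱼ η̄ʲ`. -/
def ofSymbol : (ℕ →₀ SuperFun) →ₗ[ℝ] DiffOp :=
  Finsupp.lsum ℝ fun j => LinearMap.mulRight ℝ (dEtaBar ^ j) ∘ₗ dmul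

theorem ofSymbol_single (j : ℕ) (a : SuperFun) :
    ofSymbol (Finsupp.single j a) = dmul a * dEtaBar ^ j := by
  simp [ofSymbol]

theorem ofSymbol_apply (a : ℕ →₀ SuperFun) (F : SuperFun) :
    toOp (ofSymbol a) F = a.sum fun j b => b * (etaBar ^ j) F := by
  simp [ofSymbol, Finsupp.sum]

/-- Iterated `η̄`-antiderivatives of `1` are test functions on which the powers of `η̄` act
triangularly, so the coefficients are recovered one after another. -/
theorem ofSymbol_injective : Function.Injective ofSymbol := by
  choose r hr using etaBar_surjective
  have hpow : ∀ i j : ℕ, (etaBar ^ i) (r^[j] 1) = if i ≤ j then r^[j - i] 1 else 0 := by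
    intro i
    induction i with
    | zero => simp
    | succ i ih =>
      intro j
      rw [pow_succ, Module.End.mul_apply]
      rcases j with _ | j
      · have h : etaBar 1 = 0 := by apply SuperFun.ext <;> simp
        simp [h]
      · rw [Function.iterate_succ_apply', hr, ih]
        simp
  rw [injective_iff_map_eq_zero]
  intro a ha
  ext1 j
  induction j using Nat.strong_induction_on with
  | _ j ih =>
    have h := ofSymbol_apply a (r^[j] 1)
    rw [ha, Finsupp.sum, Finset.sum_eq_single j] at h
    · simpa [hpow] using h.symm
    · intro i _ hij
      rcases lt_or_gt_of_ne hij with h' | h'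
      · rw [ih i h']
        simp
      · rw [hpow, if_neg (not_le.2 h'), mul_zero]
    · intro hj
      rw [Finsupp.notMem_support_iff.1 hj, zero_mul]

theorem pdx_eq : pdx = -etaBar ^ 2 := by
  apply LinearMap.ext
  intro F
  apply SuperFun.ext <;> simp [sq]

theorem pdθ_eq : pdθ = etaBar - mulOp sθ * etaBar ^ 2 := by
  apply LinearMap.ext
  intro F
  apply SuperFun.ext <;> simp [sq, sθ]

theorem mulOp_sθ_mul_sq_comm : mulOp sθ * etaBar ^ 2 = etaBar ^ 2 * mulOp sθ := by
  apply LinearMap.ext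
  intro F
  apply SuperFun.ext <;> simp [sq, sθ]

theorem ofSymbol_surjective : Function.Surjective ofSymbol := by
  have key : ∀ A ∈ diffOpSpan, ∃ s, toOp (ofSymbol s) = A := by
    intro A hA
    induction hA using Submodule.span_induction with
    | mem A h =>
      have hp : ∀ i : ℕ, pdx ^ i = (-1 : ℝ) ^ i • etaBar ^ (2 * i) := by
        intro i
        rw [pdx_eq, ← neg_one_smul_op, smul_pow, pow_mul]
      obtain ⟨a, i, rfl | rfl⟩ := h
      · refine ⟨(-1 : ℝ) ^ i • Finsupp.single (2 * i) a, ?_⟩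
        rw [map_smul, ofSymbol_single, hp]
        simp
      · refine ⟨(-1 : ℝ) ^ i • (Finsupp.single (2 * i + 1) a
          - Finsupp.single (2 * i + 2) (a * sθ)), ?_⟩
        -- Even powers of `η̄` are powers of `∂ₓ` up to sign, so they commute with `θ`.
        have hc : etaBar ^ (2 * i) * mulOp sθ = mulOp sθ * etaBar ^ (2 * i) := by
          rw [pow_mul]
          exact ((show Commute (etaBar ^ 2) (mulOp sθ) from
            mulOp_sθ_mul_sq_comm.symm).pow_left i).eq
        rw [map_smul, map_sub, ofSymbol_single, ofSymbol_single, hp, pdθ_eq]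
        simp only [map_smul, map_sub, map_mul, map_pow, toOp_dmul, toOp_dEtaBar, mul_smul_comm,
          smul_mul_assoc, mul_sub, smul_sub]
        rw [pow_succ, pow_add]
        congr 2
        simp only [mul_assoc]
        rw [← mul_assoc (etaBar ^ (2 * i)), hc, mul_assoc]
    | zero => exact ⟨0, by simp⟩
    | add A B _ _ hA hB =>
      obtain ⟨s, rfl⟩ := hA
      obtain ⟨t, rfl⟩ := hB
      exact ⟨s + t, by simp⟩
    | smul c A _ hA =>
      obtain ⟨s, rfl⟩ := hA
      exact ⟨c • s, by simp⟩
  intro A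
  obtain ⟨s, hs⟩ := key A.1 A.2
  exact ⟨s, toOp_injective hs⟩

/-! ### The action of `X_θ`, `X_x` and `X_{xθ}` in terms of `η̄` -/

/-- `η` as a differential operator. -/
def dEta : DiffOp := dEtaBar - (2 : ℝ) • (dmul sθ * dEtaBar ^ 2)

-- The difference `η - η̄` is `2θ∂ₓ`, and `∂ₓ = -η̄²`.
@[simp] theorem toOp_dEta : toOp dEta = eta := by
  apply LinearMap.ext
  intro F
  apply SuperFun.ext
  · simp [dEta, sθ, sq]
  · refine SmoothFun.ext fun x => ?_
    simp [dEta, sθ, sq]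
    ring

theorem dEtaBar_mul_dmul (F : SuperFun) :
    dEtaBar * dmul F = dmul (etaBar F) + dmul (parity F) * dEtaBar := by
  refine DiffOp.ext_apply fun G => ?_
  apply SuperFun.ext <;> simp [Derivation.leibniz] <;> ring

theorem dEta_mul_dmul (F : SuperFun) :
    dEta * dmul F = dmul (eta F) + dmul (parity F) * dEta := by
  refine DiffOp.ext_apply fun G => ?_
  apply SuperFun.ext <;> simp [Derivation.leibniz] <;> ring

theorem dEta_mul_dEtaBar : dEta * dEtaBar = -(dEtaBar * dEta) := by
  refine DiffOp.ext_apply fun G => ?_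
  apply SuperFun.ext <;> simp

theorem dEta_mul_dEtaBar_pow (j : ℕ) :
    dEta * dEtaBar ^ j = (-1 : ℝ) ^ j • (dEtaBar ^ j * dEta) := by
  induction j with
  | zero => simp
  | succ j ih =>
    rw [pow_succ, ← mul_assoc, ih, smul_mul_assoc, mul_assoc, dEta_mul_dEtaBar, mul_neg,
      ← mul_assoc, pow_succ, mul_neg_one, neg_smul, smul_neg]

/-- Conjugation by the parity involution. -/
def conj (A : DiffOp) : DiffOp := dParity * A * dParity

theorem conj_mul (A B : DiffOp) : conj (A * B) = conj A * conj B := by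
  calc dParity * (A * B) * dParity = dParity * A * 1 * B * dParity := by noncomm_ring
    _ = _ := by rw [← dParity_mul_dParity]; simp only [conj]; noncomm_ring

theorem conj_dmul (F : SuperFun) : conj (dmul F) = dmul (parity F) := by
  refine DiffOp.ext_apply fun G => ?_
  apply SuperFun.ext
  · simp [conj]
  · simp [conj]
    ring

theorem conj_dEtaBar : conj dEtaBar = -dEtaBar := by
  refine DiffOp.ext_apply fun G => ?_
  apply SuperFun.ext <;> simp [conj]

theorem conj_dEtaBar_pow (j : ℕ) : conj (dEtaBar ^ j) = (-1 : ℝ) ^ j • dEtaBar ^ j := by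
  induction j with
  | zero => simp [conj, dParity_mul_dParity]
  | succ j ih =>
    rw [pow_succ, conj_mul, ih, conj_dEtaBar, pow_succ, mul_neg, smul_mul_assoc, mul_neg_one,
      neg_smul]

theorem lieDensity_sθ (lam : ℝ) : lieDensity lam sθ = (1 / 2 : ℝ) • dEta := by
  refine DiffOp.ext_apply fun G => ?_
  apply SuperFun.ext <;> simp [lieDensity_fst, lieDensity_snd, sθ]

theorem lieDensity_sx_mul_sθ (lam : ℝ) :
    lieDensity lam (sx * sθ) = (1 / 2 : ℝ) • (dmul sx * dEta) + lam • dmul sθ := by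
  refine DiffOp.ext_apply fun G => ?_
  apply SuperFun.ext <;> simp [lieDensity_fst, lieDensity_snd, sθ, sx]

theorem lieDensity_sx (lam : ℝ) : lieDensity lam sx =
    (1 / 2 : ℝ) • (dmul sθ * dEtaBar) - dmul sx * dEtaBar ^ 2 + lam • 1 := by
  refine DiffOp.ext_apply fun G => ?_
  apply SuperFun.ext
  · simp [lieDensity_fst, sθ, sx, sq]
  · simp [lieDensity_snd, sθ, sx, sq]
    abel

theorem lieDiff_of_even (lam mu : ℝ) {F : SuperFun} (hF : F ∈ funPart 0) (A : DiffOp) :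
    lieDiff lam mu F A = lieDensity mu F * A - A * lieDensity lam F := by
  have h := (evenPart_add_oddPart_of_mem hF).1 rfl
  simp [lieDiff, h.1, h.2]

theorem lieDiff_of_odd (lam mu : ℝ) {F : SuperFun} (hF : F ∈ funPart 1) (A : DiffOp) :
    lieDiff lam mu F A = lieDensity mu F * A - conj A * lieDensity lam F := by
  have h := (evenPart_add_oddPart_of_mem hF).2 rfl
  simp [lieDiff, h.1, h.2, conj]

theorem sθ_mem : sθ ∈ funPart 1 := by simp [sθ]

theorem sx_mem : sx ∈ funPart 0 := by simp [sx]

theorem sx_mul_sθ_mem : sx * sθ ∈ funPart 1 := by simp [sθ, sx]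

/-- As `θ' = 0`, the density weights play no role. The signs from moving `η` past `F` and `η̄ʲ` are
those of the parity twist in the action, so only `η(F)` survives. -/
theorem lieDiff_sθ (lam mu : ℝ) (F : SuperFun) (j : ℕ) :
    lieDiff lam mu sθ (dmul F * dEtaBar ^ j) =
      (1 / 2 : ℝ) • (dmul (eta F) * dEtaBar ^ j) := by
  rw [lieDiff_of_odd _ _ sθ_mem, lieDensity_sθ, lieDensity_sθ, conj_mul, conj_dmul,
    conj_dEtaBar_pow, smul_mul_assoc, ← mul_assoc, dEta_mul_dmul, add_mul, mul_assoc (dmul _) dEta,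
    dEta_mul_dEtaBar_pow]
  simp only [mul_smul_comm, smul_mul_assoc, smul_add, mul_assoc]
  abel

theorem lieDiff_sθ_ofSymbol (lam mu : ℝ) (a : ℕ →₀ SuperFun) :
    lieDiff lam mu sθ (ofSymbol a) =
      ofSymbol ((1 / 2 : ℝ) • Finsupp.mapRange.linearMap eta a) := by
  induction a using Finsupp.induction_linear with
  | zero => simp
  | add a b ha hb => simp only [map_add, ha, hb, smul_add]
  | single j F => simp [ofSymbol_single, lieDiff_sθ]

/-- Solve `η(bⱼ) = 2aⱼ` for each coefficient. This is what makes any cocycle vanish at `X_θ` after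
subtracting a coboundary. -/
theorem lieDiff_sθ_surjective (lam mu : ℝ) : Function.Surjective (lieDiff lam mu sθ) := by
  intro A
  obtain ⟨a, rfl⟩ := ofSymbol_surjective A
  obtain ⟨b, hb⟩ := Finsupp.mapRange_surjective eta (map_zero eta) eta_surjective ((2 : ℝ) • a)
  refine ⟨ofSymbol b, ?_⟩
  rw [lieDiff_sθ_ofSymbol, Finsupp.mapRange.linearMap_apply, hb, smul_smul]
  norm_num

/-- The operator `∑ αⱼ η̄ʲ` with real coefficients. -/
def constSymbol : (ℕ →₀ ℝ) →ₗ[ℝ] DiffOp :=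
  Finsupp.lsum ℝ fun j => LinearMap.toSpanSingleton ℝ DiffOp (dEtaBar ^ j)

@[simp] theorem constSymbol_single (j : ℕ) (c : ℝ) :
    constSymbol (Finsupp.single j c) = c • dEtaBar ^ j := by
  simp [constSymbol]

/-- An operator killed by `X_θ` has constant coefficients. -/
theorem exists_constSymbol_of_lieDiff_sθ_eq_zero {lam mu : ℝ} {A : DiffOp}
    (h : lieDiff lam mu sθ A = 0) : ∃ α, A = constSymbol α := by
  obtain ⟨a, rfl⟩ := ofSymbol_surjective A
  rw [lieDiff_sθ_ofSymbol, ← map_zero ofSymbol] at h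
  have h' := (smul_eq_zero.1 (ofSymbol_injective h)).resolve_left (by norm_num)
  have hj : ∀ j, ∃ c : ℝ, a j = c • 1 := fun j => exists_eq_smul_one_of_eta_eq_zero <| by
    simpa using DFunLike.congr_fun h' j
  choose α hα using hj
  refine ⟨a.support.sum fun j => Finsupp.single j (α j), ?_⟩
  rw [map_sum]
  conv_lhs => rw [← Finsupp.sum_single a, Finsupp.sum, map_sum]
  refine Finset.sum_congr rfl fun j _ => ?_
  rw [ofSymbol_single, hα, map_smul, dmul_one, smul_mul_assoc, one_mul, constSymbol_single]

theorem constSymbol_eq_ofSymbol (α : ℕ →₀ ℝ) :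
    constSymbol α = ofSymbol (Finsupp.mapRange.linearMap (LinearMap.toSpanSingleton ℝ _ 1) α) := by
  induction α using Finsupp.induction_linear with
  | zero => simp
  | add a b ha hb => simp only [map_add, ha, hb]
  | single j c => simp [ofSymbol_single]

theorem constSymbol_injective : Function.Injective constSymbol := by
  rw [injective_iff_map_eq_zero]
  intro α h
  rw [constSymbol_eq_ofSymbol, ← map_zero ofSymbol] at h
  ext j
  have h' := congrArg SuperFun.fst (DFunLike.congr_fun (ofSymbol_injective h) j)
  simpa using congrArg (fun f : SmoothFun => f.toFun 0) h'

/-! The commutation relations between `x`, `θ` and `η̄`. -/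

theorem dEtaBar_mul_θ : dEtaBar * dmul sθ = 1 - dmul sθ * dEtaBar := by
  have h1 : etaBar sθ = 1 := by apply SuperFun.ext <;> simp [sθ]
  have h2 : parity sθ = -sθ := by apply SuperFun.ext <;> simp [sθ]
  rw [dEtaBar_mul_dmul, h1, h2, dmul_one, map_neg, neg_mul, sub_eq_add_neg]

theorem dEtaBar_mul_x : dEtaBar * dmul sx = dmul sx * dEtaBar - dmul sθ := by
  have h1 : etaBar sx = -sθ := by apply SuperFun.ext <;> simp [sθ, sx]
  have h2 : parity sx = sx := by apply SuperFun.ext <;> simp [sx]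
  rw [dEtaBar_mul_dmul, h1, h2, map_neg]
  abel

theorem θ_mul_θ : dmul sθ * dmul sθ = 0 := by
  rw [← dmul_mul, show sθ * sθ = 0 by apply SuperFun.ext <;> simp [sθ], map_zero]

/-- The weights of the powers of `η̄` under `X_x`. -/
def weight (lam mu : ℝ) (j : ℕ) : ℝ := mu - lam - j / 2

/-- The Euler field `X_x`. -/
def euler : DiffOp := (1 / 2 : ℝ) • (dmul sθ * dEtaBar) - dmul sx * dEtaBar ^ 2

/-- The action is a commutator with the Euler field, shifted by the difference of the density
weights; the next lemmas say that `η̄` and `θ` have weights `-½` and `½`. -/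
theorem lieDiff_sx (lam mu : ℝ) (A : DiffOp) :
    lieDiff lam mu sx A = euler * A - A * euler + (mu - lam) • A := by
  rw [lieDiff_of_even _ _ sx_mem, lieDensity_sx, lieDensity_sx, ← euler, add_mul, mul_add,
    smul_mul_assoc, mul_smul_comm, one_mul, mul_one, sub_smul]
  abel

theorem euler_mul_dEtaBar : euler * dEtaBar = dEtaBar * euler - (1 / 2 : ℝ) • dEtaBar := by
  refine DiffOp.ext_apply fun G => ?_
  apply SuperFun.ext <;> refine SmoothFun.ext fun x => ?_ <;>
    simp [euler, sq, sx, sθ, Derivation.leibniz] <;> ring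

theorem euler_mul_θ : euler * dmul sθ = dmul sθ * euler + (1 / 2 : ℝ) • dmul sθ := by
  refine DiffOp.ext_apply fun G => ?_
  apply SuperFun.ext <;> refine SmoothFun.ext fun x => ?_ <;>
    simp [euler, sq, sx, sθ] <;> ring

theorem euler_mul_dEtaBar_pow (j : ℕ) :
    euler * dEtaBar ^ j = dEtaBar ^ j * euler - (j / 2 : ℝ) • dEtaBar ^ j := by
  induction j with
  | zero => simp
  | succ j ih =>
    rw [pow_succ, ← mul_assoc, ih, sub_mul, mul_assoc, euler_mul_dEtaBar, mul_sub,
      ← mul_assoc, smul_mul_assoc, mul_smul_comm, sub_sub, ← add_smul]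
    congr 2
    push_cast
    ring

theorem lieDiff_sx_pow (lam mu : ℝ) (j : ℕ) :
    lieDiff lam mu sx (dEtaBar ^ j) = weight lam mu j • dEtaBar ^ j := by
  rw [lieDiff_sx, euler_mul_dEtaBar_pow, weight, sub_smul (mu - lam)]
  abel

theorem lieDiff_sx_θ_mul_pow (lam mu : ℝ) (j : ℕ) :
    lieDiff lam mu sx (dmul sθ * dEtaBar ^ j) =
      (weight lam mu j + 1 / 2) • (dmul sθ * dEtaBar ^ j) := by
  rw [lieDiff_sx, ← mul_assoc, euler_mul_θ, add_mul, mul_assoc, euler_mul_dEtaBar_pow, weight,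
    mul_sub, smul_mul_assoc, mul_smul_comm, add_smul, sub_smul (mu - lam), ← mul_assoc]
  abel

/-- The coefficient of `η̄ʲ⁻¹` in `X_{xθ} · η̄ʲ`. -/
def lowerCoeff (lam : ℝ) (j : ℕ) : ℝ := if Even j then j / 4 else lam + (j - 1) / 4

theorem sq_pow_mul_θ (m : ℕ) :
    (dEtaBar ^ 2) ^ m * dmul sθ = dmul sθ * (dEtaBar ^ 2) ^ m := by
  have h : Commute (dEtaBar ^ 2) (dmul sθ) := DiffOp.ext_apply fun G => by
    apply SuperFun.ext <;> simp [sq, sθ]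
  exact (h.pow_left m).eq

/-- The Leibniz formula for `(-∂ₓ)ᵐ`, cut off after the first derivative because `F'' = 0`. For `m =
0` the truncated exponent is harmless, its coefficient being zero. -/
theorem sq_pow_mul_dmul {F : SuperFun} (hF : pdx (pdx F) = 0) (m : ℕ) :
    (dEtaBar ^ 2) ^ m * dmul F =
      dmul F * (dEtaBar ^ 2) ^ m - (m : ℝ) • (dmul (pdx F) * (dEtaBar ^ 2) ^ (m - 1)) := by
  have hS : ∀ G : SuperFun,
      dEtaBar ^ 2 * dmul G = dmul G * dEtaBar ^ 2 - dmul (pdx G) := fun G =>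
    DiffOp.ext_apply fun K => by
      apply SuperFun.ext <;> refine SmoothFun.ext fun x => ?_ <;>
        simp [sq, Derivation.leibniz] <;> ring
  induction m with
  | zero => simp
  | succ m ih =>
    rw [pow_succ', mul_assoc, ih, mul_sub, ← mul_assoc, hS, mul_smul_comm, ← mul_assoc, hS, hF,
      map_zero, sub_zero, mul_assoc (dmul (pdx F)), sub_mul, mul_assoc, ← pow_succ',
      Nat.add_sub_cancel]
    rcases m with _ | m
    · simp
    · rw [Nat.add_sub_cancel, ← pow_succ', Nat.cast_succ (m + 1), add_smul, one_smul]
      abel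

theorem sq_pow_mul_x (m : ℕ) :
    (dEtaBar ^ 2) ^ m * dmul sx =
      dmul sx * (dEtaBar ^ 2) ^ m - (m : ℝ) • (dEtaBar ^ 2) ^ (m - 1) := by
  have h1 : pdx sx = 1 := by apply SuperFun.ext <;> simp [sx]
  have h2 : pdx (pdx sx) = 0 := by apply SuperFun.ext <;> simp [sx]
  rw [sq_pow_mul_dmul h2, h1, dmul_one, one_mul]

theorem sq_pow_mul_dEta (m : ℕ) : (dEtaBar ^ 2) ^ m * dEta =
    (dEtaBar ^ 2) ^ m * dEtaBar - (2 : ℝ) • (dmul sθ * (dEtaBar ^ 2) ^ (m + 1)) := by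
  rw [dEta, mul_sub, mul_smul_comm, ← mul_assoc _ (dmul sθ), sq_pow_mul_θ, mul_assoc, ← pow_succ]

theorem dEta_mul_sq_pow (m : ℕ) :
    dEta * (dEtaBar ^ 2) ^ m = (dEtaBar ^ 2) ^ m * dEta := by
  rw [← pow_mul, dEta_mul_dEtaBar_pow, pow_mul]
  simp

theorem lieDiff_sx_mul_sθ_pow_two_mul (lam mu : ℝ) (m : ℕ) :
    lieDiff lam mu (sx * sθ) (dEtaBar ^ (2 * m)) =
      (mu - lam - m) • (dmul sθ * dEtaBar ^ (2 * m))
        + (m / 2 : ℝ) • dEtaBar ^ (2 * m - 1) := by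
  rw [lieDiff_of_odd _ _ sx_mul_sθ_mem, conj_dEtaBar_pow, lieDensity_sx_mul_sθ,
    lieDensity_sx_mul_sθ, pow_mul, pow_mul]
  simp only [even_two, Even.neg_pow, one_pow, one_smul, add_mul, mul_add, smul_mul_assoc,
    mul_smul_comm]
  rw [mul_assoc (dmul sx), dEta_mul_sq_pow, ← mul_assoc _ (dmul sx), sq_pow_mul_x, sq_pow_mul_θ,
    sub_mul, mul_assoc, smul_sub, smul_mul_assoc]
  -- The case `m = 0` is separate because of the truncated exponent `m - 1`.
  rcases m with _ | m
  · simp [sub_smul]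
  · rw [Nat.add_sub_cancel, sq_pow_mul_dEta m, show 2 * (m + 1) - 1 = 2 * m + 1 by omega,
      pow_succ dEtaBar (2 * m), pow_mul]
    module

theorem lieDiff_sx_mul_sθ_pow_two_mul_add_one (lam mu : ℝ) (m : ℕ) :
    lieDiff lam mu (sx * sθ) (dEtaBar ^ (2 * m + 1)) =
      (mu - lam - m - 1 / 2) • (dmul sθ * dEtaBar ^ (2 * m + 1))
        + (lam + m / 2 : ℝ) • dEtaBar ^ (2 * m) := by
  rw [lieDiff_of_odd _ _ sx_mul_sθ_mem, conj_dEtaBar_pow, lieDensity_sx_mul_sθ,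
    lieDensity_sx_mul_sθ, pow_succ dEtaBar, pow_mul, pow_succ (-1 : ℝ), pow_mul]
  simp only [even_two, Even.neg_pow, one_pow, mul_neg_one, neg_smul, one_smul, add_mul, mul_add,
    smul_mul_assoc, mul_smul_comm, neg_mul]
  -- The identities `hX`, `hT` and `hE` move `x` and `θ` to the left; the terms in `x` then cancel.
  have hX : (dEtaBar ^ 2) ^ m * dEtaBar * (dmul sx * dEta) =
      dmul sx * (dEtaBar ^ 2) ^ m * dEtaBar * dEta
        - (m : ℝ) • ((dEtaBar ^ 2) ^ (m - 1) * (dEtaBar * dEta))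
        - dmul sθ * ((dEtaBar ^ 2) ^ m * dEta) := by
    rw [← mul_assoc, mul_assoc _ _ (dmul sx), dEtaBar_mul_x, mul_sub, ← mul_assoc,
      sq_pow_mul_x, sq_pow_mul_θ]
    simp only [sub_mul, smul_mul_assoc, mul_assoc]
  have hT : (dEtaBar ^ 2) ^ m * dEtaBar * dmul sθ =
      (dEtaBar ^ 2) ^ m - dmul sθ * ((dEtaBar ^ 2) ^ m * dEtaBar) := by
    rw [mul_assoc, dEtaBar_mul_θ, mul_sub, mul_one, ← mul_assoc, sq_pow_mul_θ, mul_assoc]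
  have hE : dmul sx * dEta * ((dEtaBar ^ 2) ^ m * dEtaBar) =
      -(dmul sx * (dEtaBar ^ 2) ^ m * dEtaBar * dEta) := by
    rw [mul_assoc, ← mul_assoc dEta, dEta_mul_sq_pow, mul_assoc _ dEta, dEta_mul_dEtaBar]
    simp only [mul_neg, mul_assoc]
  -- After multiplication by `θ`, `η` and `η̄` agree, since they differ by a multiple of `θ` and `θ²
  -- = 0`.
  have hTE : dmul sθ * ((dEtaBar ^ 2) ^ m * dEta) = dmul sθ * ((dEtaBar ^ 2) ^ m * dEtaBar) := by
    rw [sq_pow_mul_dEta, mul_sub, mul_smul_comm, ← mul_assoc _ (dmul sθ), θ_mul_θ, zero_mul,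
      smul_zero, sub_zero]
  rw [hX, hT, hE, hTE]
  rcases m with _ | m
  · simp only [pow_zero, one_mul, Nat.cast_zero]
    module
  · have hN : (dEtaBar ^ 2) ^ m * (dEtaBar * dEta) = -(dEtaBar ^ 2) ^ (m + 1)
        + (2 : ℝ) • (dmul sθ * ((dEtaBar ^ 2) ^ (m + 1) * dEtaBar)) := by
      rw [← neg_eq_iff_eq_neg.2 dEta_mul_dEtaBar, mul_neg, ← mul_assoc, sq_pow_mul_dEta,
        sub_mul, mul_assoc _ dEtaBar, ← sq, ← pow_succ, smul_mul_assoc, mul_assoc (dmul sθ)]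
      abel
    rw [Nat.add_sub_cancel, hN]
    module

/-- On a power of weight zero the `θ` term disappears, and `X_{xθ}` simply lowers the degree by one.
The vanishing of the remaining coefficient singles out the exceptional `λ`. -/
theorem lieDiff_sx_mul_sθ_pow (lam mu : ℝ) (j : ℕ) :
    lieDiff lam mu (sx * sθ) (dEtaBar ^ j) =
      weight lam mu j • (dmul sθ * dEtaBar ^ j) + lowerCoeff lam j • dEtaBar ^ (j - 1) := by
  rcases Nat.even_or_odd' j with ⟨m, rfl | rfl⟩
  · rw [lieDiff_sx_mul_sθ_pow_two_mul, weight, lowerCoeff, if_pos (even_two_mul m)]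
    congr 2 <;> push_cast <;> ring
  · rw [lieDiff_sx_mul_sθ_pow_two_mul_add_one, weight, lowerCoeff,
      if_neg (Nat.not_even_two_mul_add_one m), Nat.add_sub_cancel]
    congr 2 <;> push_cast <;> ring

/-! ### Inhomogeneous cocycles, separation of parities, and bases of the first cohomology. -/

namespace SuperModule

variable {g A : Type} [AddCommGroup g] [Module ℝ g] [AddCommGroup A] [Module ℝ A]
  {L : LieSuperalgebra g} (M : SuperModule L A)

/-- One-cocycles that need not be homogeneous. -/
def totalZ1 : Submodule ℝ (g →ₗ[ℝ] A) where
  carrier := {c | ∀ q r : ZMod 2, ∀ x ∈ L.part q, ∀ y ∈ L.part r, M.delta1 c q r x y = 0}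
  add_mem' := fun {c d} hc hd q r x hx y hy => by
    have h : M.delta1 (c + d) q r x y = M.delta1 c q r x y + M.delta1 d q r x y := by
      simp only [delta1, LinearMap.add_apply, map_add, smul_add]
      abel
    rw [h, hc q r x hx y hy, hd q r x hx y hy, add_zero]
  zero_mem' := fun q r x _ y _ => by simp [delta1]
  smul_mem' := fun a c hc q r x hx y hy => by
    have h : M.delta1 (a • c) q r x y = a • M.delta1 c q r x y := by
      simp only [delta1, LinearMap.smul_apply, map_smul, smul_add, smul_sub]
      rw [smul_comm a]
    rw [h, hc q r x hx y hy, smul_zero]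

variable {M}

theorem apply_bracket {c : g →ₗ[ℝ] A} (hc : c ∈ M.totalZ1) {q r : ZMod 2} {x y : g}
    (hx : x ∈ L.part q) (hy : y ∈ L.part r) :
    c (L.bracket x y) = M.act x (c y) - sgn (q * r) • M.act y (c x) := by
  have h : c (L.bracket x y) - M.act x (c y) + sgn (q * r) • M.act y (c x) = 0 :=
    hc q r x hx y hy
  rw [← sub_eq_zero, ← h]
  abel

variable (M)

theorem delta0_apply (a : A) (x : g) : M.delta0 a x = -M.act x a := rfl

theorem delta0_mem_totalZ1 (a : A) : M.delta0 a ∈ M.totalZ1 := by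
  intro q r x hx y hy
  simp only [delta1, delta0_apply, map_neg, M.act_bracket hx hy, smul_neg]
  abel

theorem part_disjoint (p : ZMod 2) : Disjoint (M.part p) (M.part (p + 1)) := by
  rcases parity_cases p with rfl | rfl
  · exact M.isCompl.disjoint
  · exact M.isCompl.disjoint.symm

theorem exists_add_eq (p : ZMod 2) (a : A) :
    ∃ b ∈ M.part p, ∃ d ∈ M.part (p + 1), b + d = a := by
  have h : a ∈ M.part 0 ⊔ M.part 1 := by
    rw [M.isCompl.sup_eq_top]
    exact Submodule.mem_top
  obtain ⟨b, hb, d, hd, rfl⟩ := Submodule.mem_sup.1 h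
  rcases parity_cases p with rfl | rfl
  · exact ⟨b, hb, d, hd, rfl⟩
  · exact ⟨d, hd, b, hb, add_comm d b⟩

/-- A homogeneous cochain which is cohomologous to a cochain of the opposite parity is the
coboundary of a homogeneous element. -/
theorem mem_B1_of_sub_mem_C1 {p : ZMod 2} {c : g →ₗ[ℝ] A} (hc : c ∈ M.C1 p) (a : A)
    (h : c - M.delta0 a ∈ M.C1 (p + 1)) : c ∈ M.B1 p := by
  obtain ⟨b, hb, d, hd, rfl⟩ := M.exists_add_eq p a
  have h1 : c - M.delta0 b ∈ M.C1 p :=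
    sub_mem hc (M.B1_le_Z1 p (Submodule.mem_map_of_mem hb)).1
  have h2 : c - M.delta0 b ∈ M.C1 (p + 1) := by
    have := add_mem h (M.B1_le_Z1 (p + 1) (Submodule.mem_map_of_mem hd)).1
    rwa [map_add, ← sub_sub, sub_add_cancel] at this
  -- With `b` the parity `p` component of `a`, the cochain `c - δb` has both parities at once, so it
  -- vanishes.
  have h3 : ∀ q : ZMod 2, ∀ x ∈ L.part q, (c - M.delta0 b) x = 0 := fun q x hx =>
    Submodule.disjoint_def.1 (M.part_disjoint (p + q)) _ (h1 q x hx)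
      (by rw [add_right_comm]; exact h2 q x hx)
  refine ⟨b, hb, (sub_eq_zero.1 (LinearMap.ext fun x => ?_)).symm⟩
  have hx : x ∈ L.part 0 ⊔ L.part 1 := by
    rw [L.isCompl.sup_eq_top]
    exact Submodule.mem_top
  obtain ⟨y, hy, z, hz, rfl⟩ := Submodule.mem_sup.1 hx
  rw [map_add, h3 0 y hy, h3 1 z hz, add_zero, LinearMap.zero_apply]

theorem H1_subsingleton_of_le {p : ZMod 2} (h : M.Z1 p ≤ M.B1 p) : Subsingleton (M.H1 p) := by
  rw [Submodule.Quotient.subsingleton_iff, Submodule.submoduleOf_eq_top]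
  exact h

/-- Cocycles that are independent and generate modulo coboundaries give a basis of the first
cohomology. -/
theorem exists_basis_H1 {p : ZMod 2} {n : ℕ} (v : Fin n → g →ₗ[ℝ] A) (hv : ∀ i, v i ∈ M.Z1 p)
    (hli : ∀ a : Fin n → ℝ, ∑ i, a i • v i ∈ M.B1 p → a = 0)
    (hsp : ∀ c ∈ M.Z1 p, ∃ a : Fin n → ℝ, c - ∑ i, a i • v i ∈ M.B1 p) :
    ∃ b : Module.Basis (Fin n) ℝ (M.H1 p), ∀ i, b i = M.cohClass (v i) (hv i) := by
  let w : Fin n → M.H1 p := fun i => M.cohClass (v i) (hv i)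
  have hw : ∀ a : Fin n → ℝ, ∑ i, a i • w i =
      Submodule.Quotient.mk (∑ i, a i • (⟨v i, hv i⟩ : M.Z1 p)) := by
    intro a
    change _ = Submodule.mkQ _ _
    rw [map_sum]
    rfl
  refine ⟨Module.Basis.mk (v := w) ?_ ?_, fun i => Module.Basis.mk_apply _ _ i⟩
  · rw [Fintype.linearIndependent_iff]
    intro a ha i
    rw [hw, Submodule.Quotient.mk_eq_zero, Submodule.submoduleOf, Submodule.mem_comap] at ha
    exact congrFun (hli a (by simpa using ha)) i
  · rintro z -
    obtain ⟨⟨c, hc⟩, rfl⟩ := Submodule.Quotient.mk_surjective _ z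
    obtain ⟨a, ha⟩ := hsp c hc
    rw [Submodule.mem_span_range_iff_exists_fun]
    refine ⟨a, ?_⟩
    rw [hw, eq_comm, Submodule.Quotient.eq, Submodule.submoduleOf, Submodule.mem_comap]
    simpa using ha

end SuperModule

/-! ### Cocycles of `osp(1|2)` -/

/-- `X_θ` as an element of `osp(1|2)`. -/
def ospθ : osp12 := ⟨sθ, Submodule.subset_span (by simp)⟩

/-- `X_{xθ}` as an element of `osp(1|2)`. -/
def ospxθ : osp12 := ⟨sx * sθ, Submodule.subset_span (by simp)⟩

/-- `X_1` as an element of `osp(1|2)`. -/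
def osp1 : osp12 := ⟨1, Submodule.subset_span (by simp)⟩

/-- `X_x` as an element of `osp(1|2)`. -/
def ospx : osp12 := ⟨sx, Submodule.subset_span (by simp)⟩

/-- `X_{x²}` as an element of `osp(1|2)`. -/
def ospx2 : osp12 := ⟨sx ^ 2, Submodule.subset_span (by simp)⟩

theorem ospθ_mem : ospθ ∈ osp.part 1 := sθ_mem
theorem ospxθ_mem : ospxθ ∈ osp.part 1 := sx_mul_sθ_mem
theorem ospx_mem : ospx ∈ osp.part 0 := sx_mem

theorem osp_bracket_coe (F G : osp12) :
    (osp.bracket F G : SuperFun) = contactBracket F G := rfl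

/-- This bracket and the next two show that the odd elements `X_θ` and `X_{xθ}` generate `osp(1|2)`.
-/
theorem bracket_θ_θ : osp.bracket ospθ ospθ = (1 / 2 : ℝ) • osp1 := by
  apply Subtype.ext
  rw [osp_bracket_coe]
  apply SuperFun.ext <;> simp [contactBracket_fst, contactBracket_snd, ospθ, osp1, sθ]

theorem bracket_θ_xθ : osp.bracket ospθ ospxθ = (1 / 2 : ℝ) • ospx := by
  apply Subtype.ext
  rw [osp_bracket_coe]
  apply SuperFun.ext <;>
    simp [contactBracket_fst, contactBracket_snd, ospθ, ospxθ, ospx, sθ, sx]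

theorem bracket_xθ_xθ : osp.bracket ospxθ ospxθ = (1 / 2 : ℝ) • ospx2 := by
  apply Subtype.ext
  rw [osp_bracket_coe]
  apply SuperFun.ext <;>
    simp [contactBracket_fst, contactBracket_snd, ospxθ, ospx2, sθ, sx, sq]

theorem bracket_x_θ : osp.bracket ospx ospθ = -((1 / 2 : ℝ) • ospθ) := by
  apply Subtype.ext
  rw [osp_bracket_coe]
  apply SuperFun.ext <;>
    simp [contactBracket_fst, contactBracket_snd, ospθ, ospx, sθ, sx]

theorem bracket_x_xθ : osp.bracket ospx ospxθ = (1 / 2 : ℝ) • ospxθ := by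
  apply Subtype.ext
  rw [osp_bracket_coe]
  apply SuperFun.ext
  · simp [contactBracket_fst, ospxθ, ospx, sθ, sx]
  · refine SmoothFun.ext fun x => ?_
    simp [contactBracket_snd, ospxθ, ospx, sθ, sx]
    ring

theorem osp12_eq (F : osp12) : ∃ a₀ a₁ a₂ b₁ b₀ : ℝ,
    F = a₀ • osp1 + a₁ • ospx + a₂ • ospx2 + b₁ • ospxθ + b₀ • ospθ := by
  obtain ⟨a₀, a₁, a₂, b₁, b₀, h0, h1⟩ := (mem_osp12_iff F).1 F.2
  refine ⟨a₀, a₁, a₂, b₁, b₀, Subtype.ext (SuperFun.ext ?_ ?_)⟩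
  · simp [h0, osp1, ospx, ospx2, ospxθ, ospθ, sx, sθ, sq]
  · simp [h1, osp1, ospx, ospx2, ospxθ, ospθ, sx, sθ, sq]

theorem act_eq_lieDiff (lam mu : ℝ) (F : osp12) (A : DiffOp) :
    (diffOpModule lam mu).act F A = lieDiff lam mu F A := rfl

section

variable {lam mu : ℝ} {c : osp12 →ₗ[ℝ] DiffOp}

/-- The cocycle identity at `(X_θ, X_θ)`: two equal terms on the right and `½` on the left give the
factor `4`. -/
theorem cocycle_osp1 (hc : c ∈ (diffOpModule lam mu).totalZ1) :
    c osp1 = (4 : ℝ) • lieDiff lam mu sθ (c ospθ) := by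
  have h := SuperModule.apply_bracket hc ospθ_mem ospθ_mem
  rw [bracket_θ_θ, map_smul, act_eq_lieDiff] at h
  simp only [mul_one, sgn_one, neg_smul, one_smul, sub_neg_eq_add] at h
  have h' := congrArg (fun A : DiffOp => (2 : ℝ) • A) h
  simp only [smul_smul] at h'
  norm_num at h'
  rw [h', ← two_smul ℝ, smul_smul, ospθ]
  norm_num

theorem cocycle_ospx2 (hc : c ∈ (diffOpModule lam mu).totalZ1) :
    c ospx2 = (4 : ℝ) • lieDiff lam mu (sx * sθ) (c ospxθ) := by
  have h := SuperModule.apply_bracket hc ospxθ_mem ospxθ_mem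
  rw [bracket_xθ_xθ, map_smul, act_eq_lieDiff] at h
  simp only [mul_one, sgn_one, neg_smul, one_smul, sub_neg_eq_add] at h
  have h' := congrArg (fun A : DiffOp => (2 : ℝ) • A) h
  simp only [smul_smul] at h'
  norm_num at h'
  rw [h', ← two_smul ℝ, smul_smul, ospxθ]
  norm_num

theorem cocycle_ospx (hc : c ∈ (diffOpModule lam mu).totalZ1) :
    c ospx = (2 : ℝ) • (lieDiff lam mu sθ (c ospxθ) + lieDiff lam mu (sx * sθ) (c ospθ)) := by
  have h := SuperModule.apply_bracket hc ospθ_mem ospxθ_mem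
  rw [bracket_θ_xθ, map_smul, act_eq_lieDiff, act_eq_lieDiff] at h
  simp only [mul_one, sgn_one, neg_smul, one_smul, sub_neg_eq_add] at h
  have h' := congrArg (fun A : DiffOp => (2 : ℝ) • A) h
  simp only [smul_smul] at h'
  norm_num at h'
  rw [h', ospθ, ospxθ]
  simp

/-- A cocycle is determined by its values at `X_θ` and `X_{xθ}`. -/
theorem cocycle_eq_zero (hc : c ∈ (diffOpModule lam mu).totalZ1) (h1 : c ospθ = 0)
    (h2 : c ospxθ = 0) : c = 0 := by
  have h3 : c osp1 = 0 := by rw [cocycle_osp1 hc, h1, map_zero, smul_zero]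
  have h4 : c ospx = 0 := by rw [cocycle_ospx hc, h1, h2, map_zero, map_zero, add_zero, smul_zero]
  have h5 : c ospx2 = 0 := by rw [cocycle_ospx2 hc, h2, map_zero, smul_zero]
  ext1 F
  obtain ⟨a₀, a₁, a₂, b₁, b₀, rfl⟩ := osp12_eq F
  simp [h1, h2, h3, h4, h5]

theorem lieDiff_sθ_pow (j : ℕ) : lieDiff lam mu sθ (dEtaBar ^ j) = 0 := by
  have h : eta 1 = 0 := by apply SuperFun.ext <;> simp
  simpa [h] using lieDiff_sθ lam mu 1 j

theorem lieDiff_sθ_constSymbol (α : ℕ →₀ ℝ) : lieDiff lam mu sθ (constSymbol α) = 0 := by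
  induction α using Finsupp.induction_linear with
  | zero => simp
  | add a b ha hb => simp only [map_add, ha, hb, add_zero]
  | single j r => rw [constSymbol_single, map_smul, lieDiff_sθ_pow, smul_zero]

theorem lieDiff_sθ_θ_mul_constSymbol (α : ℕ →₀ ℝ) :
    lieDiff lam mu sθ (dmul sθ * constSymbol α) = (1 / 2 : ℝ) • constSymbol α := by
  have h : eta sθ = 1 := by apply SuperFun.ext <;> simp [sθ]
  induction α using Finsupp.induction_linear with
  | zero => simp
  | add a b ha hb => simp only [map_add, mul_add, ha, hb, smul_add]
  | single j r =>
    rw [constSymbol_single, mul_smul_comm, map_smul, lieDiff_sθ, h, dmul_one, one_mul, smul_comm]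

theorem lieDiff_sx_constSymbol (α : ℕ →₀ ℝ) :
    lieDiff lam mu sx (constSymbol α) = constSymbol (weight lam mu • α) := by
  induction α using Finsupp.induction_linear with
  | zero =>
    rw [show weight lam mu • (0 : ℕ →₀ ℝ) = 0 by ext; simp]
    simp
  | add a b ha hb =>
    rw [show weight lam mu • (a + b) = weight lam mu • a + weight lam mu • b by
      ext; simp, map_add, map_add, map_add, ha, hb]
  | single j r =>
    have h : weight lam mu • Finsupp.single j r = Finsupp.single j (weight lam mu j * r) := by
      ext i
      by_cases hij : j = i
      · subst hij
        simp
      · simp [Finsupp.single_eq_of_ne' hij]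
    rw [h, constSymbol_single, constSymbol_single, map_smul, lieDiff_sx_pow, smul_smul, mul_comm]

/-- Left multiplication by `θ` raises the weight by `½`, starting here from weight zero. -/
theorem lieDiff_sx_θ_mul_constSymbol (α : ℕ →₀ ℝ) (hα : weight lam mu • α = 0) :
    lieDiff lam mu sx (dmul sθ * constSymbol α) = (1 / 2 : ℝ) • (dmul sθ * constSymbol α) := by
  have h : ∀ β : ℕ →₀ ℝ, lieDiff lam mu sx (dmul sθ * constSymbol β) =
      dmul sθ * lieDiff lam mu sx (constSymbol β) + (1 / 2 : ℝ) • (dmul sθ * constSymbol β) := by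
    intro β
    induction β using Finsupp.induction_linear with
    | zero => simp
    | add a b ha hb => simp only [map_add, mul_add, ha, hb, smul_add]; abel
    | single j r =>
      rw [constSymbol_single, mul_smul_comm, map_smul, map_smul, lieDiff_sx_θ_mul_pow,
        lieDiff_sx_pow, add_smul, mul_smul_comm, mul_smul_comm, smul_add, smul_comm r (1 / 2 : ℝ)]
  rw [h, lieDiff_sx_constSymbol, hα, map_zero, mul_zero, zero_add]

/-- Up to a coboundary, a cocycle vanishes at `X_θ` and takes at `X_{xθ}` a value whose
coefficients are of degree at most one in `θ` and constant in `x`. -/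
theorem exists_normal_form (hc : c ∈ (diffOpModule lam mu).totalZ1) :
    ∃ (A : DiffOp) (β γ : ℕ →₀ ℝ), (c - (diffOpModule lam mu).delta0 A) ospθ = 0 ∧
      (c - (diffOpModule lam mu).delta0 A) ospxθ = dmul sθ * constSymbol β + constSymbol γ ∧
      weight lam mu • β = 0 ∧
      lieDiff lam mu (sx * sθ) (constSymbol β)
        = constSymbol (weight lam mu • γ - (1 / 2 : ℝ) • γ) := by
  obtain ⟨A, hA⟩ := lieDiff_sθ_surjective lam mu (-c ospθ)
  set c₁ := c - (diffOpModule lam mu).delta0 A with hc₁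
  have hZ₁ : c₁ ∈ (diffOpModule lam mu).totalZ1 :=
    sub_mem hc ((diffOpModule lam mu).delta0_mem_totalZ1 A)
  have h₁ : c₁ ospθ = 0 := by
    rw [hc₁, LinearMap.sub_apply, SuperModule.delta0_apply, act_eq_lieDiff]
    exact (congrArg (fun B => c ospθ - -B) hA).trans (by simp)
  -- The cocycle identity at `(X_x, X_θ)`, where `[X_x, X_θ]` is a multiple of `X_θ`.
  have key : ∀ c : osp12 →ₗ[ℝ] DiffOp, c ∈ (diffOpModule lam mu).totalZ1 → c ospθ = 0 →
      lieDiff lam mu sθ (c ospx) = 0 := by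
    intro c hc h
    have := SuperModule.apply_bracket hc ospx_mem ospθ_mem
    rw [bracket_x_θ, map_neg, map_smul, h, act_eq_lieDiff, act_eq_lieDiff] at this
    simpa [ospθ] using this
  obtain ⟨b, hb⟩ := exists_constSymbol_of_lieDiff_sθ_eq_zero (key c₁ hZ₁ h₁)
  -- Divides by the weights where they are nonzero; the convention `0⁻¹ = 0` leaves the weight zero
  -- part of `b` untouched.
  set α : ℕ →₀ ℝ := (fun j => (weight lam mu j)⁻¹) • b with hα
  set c₂ := c₁ - (diffOpModule lam mu).delta0 (-constSymbol α) with hc₂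
  have hZ₂ : c₂ ∈ (diffOpModule lam mu).totalZ1 :=
    sub_mem hZ₁ ((diffOpModule lam mu).delta0_mem_totalZ1 _)
  have h₂ : c₂ ospθ = 0 := by
    rw [hc₂, LinearMap.sub_apply, h₁, SuperModule.delta0_apply, act_eq_lieDiff, ospθ, map_neg,
      lieDiff_sθ_constSymbol]
    simp
  have hx : c₂ ospx = constSymbol (b - weight lam mu • α) := by
    rw [hc₂, LinearMap.sub_apply, hb, SuperModule.delta0_apply, act_eq_lieDiff, ospx, map_neg,
      lieDiff_sx_constSymbol, neg_neg, map_sub]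
  have hw : weight lam mu • (b - weight lam mu • α) = 0 := by
    ext j
    by_cases hj : weight lam mu j = 0
    · simp [hj]
    · simp [hα, hj]
  generalize b - weight lam mu • α = β at hx hw
  -- Since `[X_θ, X_{xθ}] = ½X_x`, the image of `c₂(X_{xθ})` under `X_θ` is `½β`, which is also the
  -- image of `θβ`.
  have hd : lieDiff lam mu sθ (c₂ ospxθ - dmul sθ * constSymbol β) = 0 := by
    have h := cocycle_ospx hZ₂
    rw [h₂, map_zero, add_zero, hx] at h
    rw [map_sub, lieDiff_sθ_θ_mul_constSymbol, h, smul_smul]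
    norm_num
  obtain ⟨γ, hγ⟩ := exists_constSymbol_of_lieDiff_sθ_eq_zero hd
  rw [sub_eq_iff_eq_add'] at hγ
  refine ⟨A - constSymbol α, β, γ, ?_, ?_, hw, ?_⟩
  · rwa [map_sub, sub_eq_add_neg _ ((diffOpModule lam mu).delta0 _), ← map_neg, ← sub_sub]
  · rwa [map_sub, sub_eq_add_neg _ ((diffOpModule lam mu).delta0 _), ← map_neg, ← sub_sub]
  -- In the identity at `(X_x, X_{xθ})` the terms `½θβ` cancel, which leaves the equation for `β`
  -- and `γ`.
  · have h := SuperModule.apply_bracket hZ₂ ospx_mem ospxθ_mem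
    rw [bracket_x_xθ, map_smul, act_eq_lieDiff, act_eq_lieDiff, hx, hγ] at h
    simp only [zero_mul, sgn_zero, one_smul] at h
    rw [ospx, ospxθ, map_add, lieDiff_sx_θ_mul_constSymbol β hw, lieDiff_sx_constSymbol] at h
    rw [LinearMap.map_sub, LinearMap.map_smul constSymbol]
    rw [smul_add, add_sub_assoc, add_right_inj] at h
    rw [h, sub_sub_cancel]

end

/-! ### The explicit cocycles -/

theorem dmul_mem {q : ZMod 2} {F : SuperFun} (hF : F ∈ funPart q) : dmul F ∈ opPart q := by
  rw [mem_opPart_iff, ← conj, conj_dmul, parity_of_mem hF, map_smul]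

theorem pdx_mem_funPart {q : ZMod 2} {F : SuperFun} (hF : F ∈ funPart q) : pdx F ∈ funPart q := by
  rcases parity_cases q with rfl | rfl <;>
    simp only [mem_funPart_zero, mem_funPart_one] at hF <;> simp [hF]

theorem parity_mem_funPart {q : ZMod 2} {F : SuperFun} (hF : F ∈ funPart q) :
    parity F ∈ funPart q := by
  rw [parity_of_mem hF]
  exact Submodule.smul_mem _ _ hF

theorem dEtaBar_pow_mem_opPart_one {j : ℕ} (hj : Odd j) : dEtaBar ^ j ∈ opPart 1 := by
  rw [mem_opPart_iff, ← conj, conj_dEtaBar_pow, hj.neg_one_pow, sgn_one]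

/-- With equal weights on both sides the terms `λF'` cancel, by supercommutativity of functions. -/
theorem lieDiff_dmul (lam : ℝ) {q r : ZMod 2} {F G : SuperFun} (hF : F ∈ funPart q)
    (hG : G ∈ funPart r) : lieDiff lam lam F (dmul G) = dmul (contactField F G) := by
  rw [lieDiff_homogeneous lam lam hF (dmul_mem hG)]
  refine DiffOp.ext_apply fun K => ?_
  rcases parity_cases q with rfl | rfl <;> rcases parity_cases r with rfl | rfl <;>
    simp only [mem_funPart_zero, mem_funPart_one] at hF hG <;>
    apply SuperFun.ext <;>
    refine SmoothFun.ext fun x => ?_ <;>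
    simp [lieDensity_fst, lieDensity_snd, contactField_fst, contactField_snd, hF, hG,
      Derivation.leibniz] <;>
    ring

/-- This is the cocycle identity for `F ↦ F'` with values in functions; it holds for all contact
fields. -/
theorem pdx_contactBracket {q r : ZMod 2} {F G : SuperFun} (hF : F ∈ funPart q)
    (hG : G ∈ funPart r) : pdx (contactBracket F G) =
      contactField F (pdx G) - sgn (q * r) • contactField G (pdx F) := by
  rcases parity_cases q with rfl | rfl <;> rcases parity_cases r with rfl | rfl <;>
    simp only [mem_funPart_zero, mem_funPart_one] at hF hG <;>
    apply SuperFun.ext <;>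
    refine SmoothFun.ext fun x => ?_ <;>
    simp [contactBracket_fst, contactBracket_snd, contactField_fst, contactField_snd, hF, hG,
      Derivation.leibniz] <;>
    ring

theorem upsilonEven_mem_Z1 (lam : ℝ) : upsilonEven ∈ (diffOpModule lam lam).Z1 0 := by
  refine ⟨fun q F hF => ?_, fun q r F hF G hG => ?_⟩
  · rw [zero_add]
    exact dmul_mem (pdx_mem_funPart hF)
  · replace hF : (F : SuperFun) ∈ funPart q := hF
    replace hG : (G : SuperFun) ∈ funPart r := hG
    change dmul (pdx (contactBracket F G)) - lieDiff lam lam F (dmul (pdx G))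
      + sgn (q * r) • lieDiff lam lam G (dmul (pdx F)) = 0
    rw [lieDiff_dmul lam hF (pdx_mem_funPart hG), lieDiff_dmul lam hG (pdx_mem_funPart hF),
      pdx_contactBracket hF hG, map_sub, map_smul]
    abel

/-! ### Odd invariant operators and the cocycles obtained by composing `F'` with them. -/

section

variable {lam mu : ℝ} {Y : DiffOp}

/-- An operator is invariant if it is killed by the action of `osp(1|2)`. -/
def IsInvariant (lam mu : ℝ) (Y : DiffOp) : Prop := ∀ F ∈ osp12, lieDiff lam mu F Y = 0

theorem IsInvariant.lieDensity_mul (h : IsInvariant lam mu Y) (hY : Y ∈ opPart 1) {q : ZMod 2}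
    {F : SuperFun} (hF : F ∈ osp12) (hq : F ∈ funPart q) :
    lieDensity mu F * Y = sgn q • (Y * lieDensity lam F) := by
  have h1 := h F hF
  rwa [lieDiff_homogeneous lam mu hq hY, one_mul, sub_eq_zero] at h1

/-- Right composition with an invariant `Y` is a module map from `𝔇_{μ,μ}` to `𝔇_{λ,μ}`, so it
carries cocycles to cocycles. -/
theorem IsInvariant.lieDiff_mul_right (h : IsInvariant lam mu Y) (hY : Y ∈ opPart 1)
    {q r : ZMod 2} {F : SuperFun} (hF : F ∈ osp12) (hq : F ∈ funPart q) {B : DiffOp}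
    (hB : B ∈ opPart r) : lieDiff lam mu F (B * Y) = lieDiff mu mu F B * Y := by
  have h1 := h.lieDensity_mul hY hF hq
  rw [lieDiff_homogeneous lam mu hq (opPart_mul_mem hB hY), lieDiff_homogeneous mu mu hq hB,
    sub_mul, smul_mul_assoc, ← mul_assoc (lieDensity mu F) B Y, mul_assoc B (lieDensity mu F) Y,
    mul_assoc B Y, h1, mul_smul_comm, smul_smul]
  congr 2
  rcases parity_cases q with rfl | rfl <;> rcases parity_cases r with rfl | rfl <;> simp

/-- Left composition starts from `𝔇_{λ,λ}`; passing the odd `Y` costs the sign `(-1)^{p(F)}`, which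
the sign in `mulLeftCochain` compensates. -/
theorem IsInvariant.lieDiff_mul_left (h : IsInvariant lam mu Y) (hY : Y ∈ opPart 1)
    {q r : ZMod 2} {F : SuperFun} (hF : F ∈ osp12) (hq : F ∈ funPart q) {B : DiffOp}
    (hB : B ∈ opPart r) : lieDiff lam mu F (Y * B) = sgn q • (Y * lieDiff lam lam F B) := by
  have h1 := h.lieDensity_mul hY hF hq
  rw [lieDiff_homogeneous lam mu hq (opPart_mul_mem hY hB), lieDiff_homogeneous lam lam hq hB,
    ← mul_assoc, h1, smul_mul_assoc, mul_sub, smul_sub, mul_smul_comm, smul_smul, mul_assoc,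
    mul_assoc]
  congr 2
  rcases parity_cases q with rfl | rfl <;> rcases parity_cases r with rfl | rfl <;> simp

/-- `X_F ↦ F' ∘ Y`. -/
def mulRightCochain (Y : DiffOp) : osp12 →ₗ[ℝ] DiffOp :=
  LinearMap.mulRight ℝ Y ∘ₗ dmul ∘ₗ pdx ∘ₗ osp12.subtype

/-- `X_F ↦ (-1)^{p(F)} Y ∘ F'`. -/
def mulLeftCochain (Y : DiffOp) : osp12 →ₗ[ℝ] DiffOp :=
  LinearMap.mulLeft ℝ Y ∘ₗ dmul ∘ₗ parity ∘ₗ pdx ∘ₗ osp12.subtype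

theorem mulRightCochain_apply (Y : DiffOp) (F : osp12) :
    mulRightCochain Y F = dmul (pdx F) * Y := rfl

theorem mulLeftCochain_apply (Y : DiffOp) (F : osp12) :
    mulLeftCochain Y F = Y * dmul (parity (pdx F)) := rfl

theorem IsInvariant.mulRightCochain_mem_Z1 (h : IsInvariant lam mu Y) (hY : Y ∈ opPart 1) :
    mulRightCochain Y ∈ (diffOpModule lam mu).Z1 1 := by
  refine ⟨fun q F hF => ?_, fun q r F hF G hG => ?_⟩
  · rw [add_comm]
    exact opPart_mul_mem (dmul_mem (pdx_mem_funPart hF)) hY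
  · replace hF : (F : SuperFun) ∈ funPart q := hF
    replace hG : (G : SuperFun) ∈ funPart r := hG
    change dmul (pdx (contactBracket F G)) * Y - lieDiff lam mu F (dmul (pdx G) * Y)
      + sgn (q * r) • lieDiff lam mu G (dmul (pdx F) * Y) = 0
    rw [h.lieDiff_mul_right hY F.2 hF (dmul_mem (pdx_mem_funPart hG)),
      h.lieDiff_mul_right hY G.2 hG (dmul_mem (pdx_mem_funPart hF)),
      lieDiff_dmul mu hF (pdx_mem_funPart hG), lieDiff_dmul mu hG (pdx_mem_funPart hF),
      pdx_contactBracket hF hG, map_sub, map_smul, sub_mul, smul_mul_assoc]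
    abel

theorem IsInvariant.mulLeftCochain_mem_Z1 (h : IsInvariant lam mu Y) (hY : Y ∈ opPart 1) :
    mulLeftCochain Y ∈ (diffOpModule lam mu).Z1 1 := by
  refine ⟨fun q F hF => ?_, fun q r F hF G hG => ?_⟩
  · exact opPart_mul_mem hY (dmul_mem (parity_mem_funPart (pdx_mem_funPart hF)))
  · replace hF : (F : SuperFun) ∈ funPart q := hF
    replace hG : (G : SuperFun) ∈ funPart r := hG
    change Y * dmul (parity (pdx (contactBracket F G)))
      - lieDiff lam mu F (Y * dmul (parity (pdx G)))
      + sgn (q * r) • lieDiff lam mu G (Y * dmul (parity (pdx F))) = 0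
    rw [parity_of_mem (pdx_mem_funPart (contactBracket_mem hF hG)),
      parity_of_mem (pdx_mem_funPart hF), parity_of_mem (pdx_mem_funPart hG), map_smul, map_smul,
      map_smul, mul_smul_comm, mul_smul_comm, mul_smul_comm, map_smul, map_smul,
      h.lieDiff_mul_left hY F.2 hF (dmul_mem (pdx_mem_funPart hG)),
      h.lieDiff_mul_left hY G.2 hG (dmul_mem (pdx_mem_funPart hF)),
      lieDiff_dmul lam hF (pdx_mem_funPart hG), lieDiff_dmul lam hG (pdx_mem_funPart hF),
      pdx_contactBracket hF hG, map_sub, map_smul, mul_sub, mul_smul_comm]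
    rcases parity_cases q with rfl | rfl <;> rcases parity_cases r with rfl | rfl <;> simp

/-- The coboundary of `Y` is a cocycle that vanishes at the two generators, hence everywhere. -/
theorem isInvariant_of_generators (h1 : lieDiff lam mu sθ Y = 0)
    (h2 : lieDiff lam mu (sx * sθ) Y = 0) : IsInvariant lam mu Y := by
  have h : (diffOpModule lam mu).delta0 Y = 0 := by
    refine cocycle_eq_zero ((diffOpModule lam mu).delta0_mem_totalZ1 Y) ?_ ?_
    · rw [SuperModule.delta0_apply, act_eq_lieDiff, ospθ, h1, neg_zero]
    · rw [SuperModule.delta0_apply, act_eq_lieDiff, ospxθ, h2, neg_zero]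
  intro F hF
  have h' := LinearMap.congr_fun h ⟨F, hF⟩
  rwa [SuperModule.delta0_apply, act_eq_lieDiff, LinearMap.zero_apply, neg_eq_zero] at h'

end

/-! ### The invariant powers of `η̄`, and the cocycles `Υ` and `Υ̃`. -/

section

variable {k : ℕ} {lam mu : ℝ}

/-- At these weights both coefficients in the action of `X_{xθ}` on the odd power vanish; constant
coefficients take care of `X_θ`. -/
theorem isInvariant_pow (hk : 1 ≤ k) (hl : lam = (1 - (k : ℝ)) / 2) (hm : mu = (k : ℝ) / 2) :
    IsInvariant lam mu (dEtaBar ^ (2 * k - 1)) := by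
  obtain ⟨m, rfl⟩ : ∃ m, k = m + 1 := ⟨k - 1, by omega⟩
  refine isInvariant_of_generators (lieDiff_sθ_pow _) ?_
  rw [show 2 * (m + 1) - 1 = 2 * m + 1 by omega, lieDiff_sx_mul_sθ_pow_two_mul_add_one, hl, hm]
  push_cast
  rw [show ((m : ℝ) + 1) / 2 - (1 - (m + 1)) / 2 - m - 1 / 2 = 0 by ring,
    show (1 - ((m : ℝ) + 1)) / 2 + m / 2 = 0 by ring, zero_smul, zero_smul, add_zero]

theorem pow_mem_opPart_one (hk : 1 ≤ k) : dEtaBar ^ (2 * k - 1) ∈ opPart 1 :=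
  dEtaBar_pow_mem_opPart_one ⟨k - 1, by omega⟩

theorem upsilonOdd_eq (k : ℕ) : upsilonOdd k = -mulRightCochain (dEtaBar ^ (2 * k - 1)) := by
  ext1 F
  have h : (etaBar ^ 2 : Op) (F : SuperFun) = -pdx F := by
    rw [pdx_eq, LinearMap.neg_apply, neg_neg]
  change dmul ((etaBar ^ 2 : Op) (F : SuperFun)) * _ = -(dmul (pdx F) * _)
  rw [h, map_neg, neg_mul]

theorem eta_sq_apply (F : SuperFun) : (eta ^ 2 : Op) F = pdx F := by
  apply SuperFun.ext <;> simp [sq]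

theorem pdx_pdx_pdx_of_mem {F : SuperFun} (hF : F ∈ osp12) :
    pdx (pdx (pdx F)) = 0 ∧ pdx (eta (pdx F)) = 0 := by
  obtain ⟨a₀, a₁, a₂, b₁, b₀, h0, h1⟩ := (mem_osp12_iff F).1 hF
  constructor <;> apply SuperFun.ext <;> simp [h0, h1, Derivation.leibniz]

/-- Expand `η̄²ᵏ⁻¹` past `F'`. On `osp(1|2)` both `F'''` and `η(F')'` vanish, so the leading terms
cancel and only those with `η(F')` and `F''` remain. -/
theorem upsilonOddTilde_eq (hk : 1 ≤ k) : upsilonOddTilde k =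
    mulRightCochain (dEtaBar ^ (2 * k - 1)) - mulLeftCochain (dEtaBar ^ (2 * k - 1)) := by
  obtain ⟨m, rfl⟩ : ∃ m, k = m + 1 := ⟨k - 1, by omega⟩
  ext1 F
  have h4 : (eta ^ 4 : Op) (F : SuperFun) = pdx (pdx F) := by
    rw [show 4 = 2 + 2 by rfl, pow_add, Module.End.mul_apply, eta_sq_apply, eta_sq_apply]
  have h3 : (eta ^ 3 : Op) (F : SuperFun) = eta (pdx F) := by
    rw [pow_succ', Module.End.mul_apply, eta_sq_apply]
  have hL : upsilonOddTilde (m + 1) F =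
      (((m + 1 : ℕ) : ℝ) - 1) • (dmul ((eta ^ 4 : Op) (F : SuperFun)) * dEtaBar ^ (2 * (m + 1) - 3))
        + dmul ((eta ^ 3 : Op) (F : SuperFun)) * dEtaBar ^ (2 * (m + 1) - 2) := rfl
  obtain ⟨hF, hF'⟩ := pdx_pdx_pdx_of_mem F.2
  rw [hL, LinearMap.sub_apply, mulRightCochain_apply, mulLeftCochain_apply, h3, h4]
  generalize pdx (F : SuperFun) = G at hF hF'
  -- The parity sign turns `η̄` into `-η` on the coefficient; this is why `Υ̃` involves powers of
  -- `η`.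
  have hG : dEtaBar * dmul (parity G) = dmul G * dEtaBar - dmul (eta G) := by
    rw [dEtaBar_mul_dmul, show etaBar (parity G) = -eta G by apply SuperFun.ext <;> simp,
      show parity (parity G) = G by apply SuperFun.ext <;> simp, map_neg]
    abel
  rw [show 2 * (m + 1) - 1 = 2 * m + 1 by omega, show 2 * (m + 1) - 2 = 2 * m by omega,
    pow_succ dEtaBar (2 * m), pow_mul, mul_assoc _ _ (dmul (parity G)), hG, mul_sub, ← mul_assoc,
    ← mul_assoc, sq_pow_mul_dmul hF, sq_pow_mul_dmul (F := eta G) (by rw [hF', map_zero]), hF',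
    map_zero, zero_mul, smul_zero, sub_zero, sub_mul, smul_mul_assoc, mul_assoc (dmul (pdx G))]
  rcases m with _ | m
  · simp
  · rw [Nat.add_sub_cancel, show 2 * (m + 1 + 1) - 3 = 2 * m + 1 by omega,
      pow_succ dEtaBar (2 * m), pow_mul, Nat.cast_succ (m + 1), add_sub_cancel_right, mul_assoc]
    abel

theorem upsilonOdd_mem_Z1 (hk : 1 ≤ k) (hl : lam = (1 - (k : ℝ)) / 2) (hm : mu = (k : ℝ) / 2) :
    upsilonOdd k ∈ (diffOpModule lam mu).Z1 1 := by
  rw [upsilonOdd_eq]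
  exact neg_mem ((isInvariant_pow hk hl hm).mulRightCochain_mem_Z1 (pow_mem_opPart_one hk))

theorem upsilonOddTilde_mem_Z1 (hk : 1 ≤ k) (hl : lam = (1 - (k : ℝ)) / 2)
    (hm : mu = (k : ℝ) / 2) : upsilonOddTilde k ∈ (diffOpModule lam mu).Z1 1 := by
  rw [upsilonOddTilde_eq hk]
  exact sub_mem ((isInvariant_pow hk hl hm).mulRightCochain_mem_Z1 (pow_mem_opPart_one hk))
    ((isInvariant_pow hk hl hm).mulLeftCochain_mem_Z1 (pow_mem_opPart_one hk))

theorem upsilonOdd_apply (k : ℕ) (F : osp12) :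
    upsilonOdd k F = dmul (etaBar (etaBar F)) * dEtaBar ^ (2 * k - 1) := rfl

theorem upsilonOddTilde_apply (k : ℕ) (F : osp12) : upsilonOddTilde k F =
    ((k : ℝ) - 1) • (dmul (eta (eta (eta (eta F)))) * dEtaBar ^ (2 * k - 3))
      + dmul (eta (eta (eta F))) * dEtaBar ^ (2 * k - 2) := rfl

/-- The values of the three cocycles at `X_θ` and `X_{xθ}` are matched with the normal form; those
at `X_x` serve for independence. -/
theorem upsilonEven_ospθ : upsilonEven ospθ = 0 := by
  change dmul (pdx sθ) = 0
  rw [show pdx sθ = 0 by apply SuperFun.ext <;> simp [sθ], map_zero]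

theorem upsilonEven_ospx : upsilonEven ospx = 1 := by
  change dmul (pdx sx) = 1
  rw [show pdx sx = 1 by apply SuperFun.ext <;> simp [sx], dmul_one]

theorem upsilonEven_ospxθ : upsilonEven ospxθ = dmul sθ := by
  change dmul (pdx (sx * sθ)) = _
  rw [show pdx (sx * sθ) = sθ by apply SuperFun.ext <;> simp [sx, sθ]]

theorem upsilonOdd_ospθ (k : ℕ) : upsilonOdd k ospθ = 0 := by
  rw [upsilonOdd_apply, show etaBar (etaBar (ospθ : SuperFun)) = 0 by
    apply SuperFun.ext <;> simp [ospθ, sθ], map_zero, zero_mul]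

theorem upsilonOdd_ospx (k : ℕ) : upsilonOdd k ospx = -dEtaBar ^ (2 * k - 1) := by
  rw [upsilonOdd_apply, show etaBar (etaBar (ospx : SuperFun)) = -1 by
    apply SuperFun.ext <;> simp [ospx, sx], map_neg, dmul_one, neg_one_mul]

theorem upsilonOdd_ospxθ (k : ℕ) :
    upsilonOdd k ospxθ = -(dmul sθ * dEtaBar ^ (2 * k - 1)) := by
  rw [upsilonOdd_apply, show etaBar (etaBar (ospxθ : SuperFun)) = -sθ by
    apply SuperFun.ext <;> simp [ospxθ, sx, sθ], map_neg, neg_mul]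

theorem upsilonOddTilde_ospθ (k : ℕ) : upsilonOddTilde k ospθ = 0 := by
  rw [upsilonOddTilde_apply, show eta (eta (eta (ospθ : SuperFun))) = 0 by
    apply SuperFun.ext <;> simp [ospθ, sθ]]
  simp

theorem upsilonOddTilde_ospx (k : ℕ) : upsilonOddTilde k ospx = 0 := by
  rw [upsilonOddTilde_apply, show eta (eta (eta (ospx : SuperFun))) = 0 by
    apply SuperFun.ext <;> simp [ospx, sx]]
  simp

theorem upsilonOddTilde_ospxθ (k : ℕ) : upsilonOddTilde k ospxθ = dEtaBar ^ (2 * k - 2) := by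
  rw [upsilonOddTilde_apply, show eta (eta (eta (ospxθ : SuperFun))) = 1 by
    apply SuperFun.ext <;> simp [ospxθ, sx, sθ], show eta 1 = 0 by apply SuperFun.ext <;> simp]
  simp

end

/-! ### Classification -/

/-- Every cocycle is, up to a coboundary, a combination of the explicit ones. -/
theorem totalZ1_classification {lam mu : ℝ} {c : osp12 →ₗ[ℝ] DiffOp}
    (hc : c ∈ (diffOpModule lam mu).totalZ1) :
    (∃ A, c = (diffOpModule lam mu).delta0 A) ∨
    (lam = mu ∧ ∃ A, ∃ b : ℝ, c = (diffOpModule lam mu).delta0 A + b • upsilonEven) ∨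
    ∃ k : ℕ, 1 ≤ k ∧ lam = (1 - (k : ℝ)) / 2 ∧ mu = (k : ℝ) / 2 ∧ ∃ A, ∃ b b' : ℝ,
      c = (diffOpModule lam mu).delta0 A + (b • upsilonOdd k + b' • upsilonOddTilde k) := by
  obtain ⟨A, β, γ, hθ, hxθ, hβ, hf⟩ := exists_normal_form hc
  set c₁ := c - (diffOpModule lam mu).delta0 A with hc₁
  have hZ : c₁ ∈ (diffOpModule lam mu).totalZ1 :=
    sub_mem hc ((diffOpModule lam mu).delta0_mem_totalZ1 A)
  have hcc : c = (diffOpModule lam mu).delta0 A + c₁ := by rw [hc₁]; abel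
  have hβj : ∀ j, weight lam mu j ≠ 0 → β j = 0 := fun j hj => by
    simpa [hj] using DFunLike.congr_fun hβ j
  by_cases hw : ∃ n, weight lam mu n = 0
  swap
  · push Not at hw
    have hβ0 : β = 0 := by
      ext j
      exact hβj j (hw j)
    rw [hβ0, map_zero, map_zero, ← map_zero constSymbol] at hf
    have hγ := constSymbol_injective hf
    have hγ0 : γ = 0 := by
      ext j
      have h1 : weight lam mu j * γ j - 1 / 2 * γ j = 0 := by
        simpa using (DFunLike.congr_fun hγ j).symm
      rw [← sub_mul] at h1
      -- If `η̄ʲ` had weight `½`, then `η̄ʲ⁺¹` would have weight zero.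
      refine (mul_eq_zero.1 h1).resolve_left fun h2 => hw (j + 1) ?_
      rw [weight] at h2 ⊢
      push_cast
      linarith
    left
    refine ⟨A, ?_⟩
    rw [hβ0, hγ0, map_zero, mul_zero, add_zero] at hxθ
    rw [hcc, cocycle_eq_zero hZ hθ hxθ, add_zero]
  obtain ⟨n, hn⟩ := hw
  have hwj : ∀ j, weight lam mu j = (n - j) / 2 := fun j => by
    rw [weight] at hn ⊢
    linarith
  obtain ⟨b, rfl⟩ : ∃ b, β = Finsupp.single n b := by
    refine ⟨β n, ?_⟩
    ext j
    by_cases hj : j = n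
    · rw [hj, Finsupp.single_eq_same]
    · rw [Finsupp.single_eq_of_ne hj]
      refine hβj j ?_
      rw [hwj]
      have : (j : ℝ) ≠ n := fun h => hj (by exact_mod_cast h)
      exact div_ne_zero (sub_ne_zero.2 this.symm) two_ne_zero
  rw [constSymbol_single] at hxθ
  rw [constSymbol_single, map_smul, lieDiff_sx_mul_sθ_pow, hn, zero_smul, zero_add, smul_smul,
    ← constSymbol_single] at hf
  -- The normal form equation, coefficient by coefficient. For `n = 0` the truncated index does not
  -- matter, since `lowerCoeff lam 0 = 0`.
  have hγ : ∀ j, (Finsupp.single (n - 1) (b * lowerCoeff lam n) : ℕ →₀ ℝ) j =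
      ((n - j) / 2 - 1 / 2) * γ j := fun j => by
    rw [constSymbol_injective hf, sub_mul, ← hwj]
    simp
  rcases n with _ | m
  · right
    left
    have hlm : lam = mu := by
      rw [weight] at hn
      push_cast at hn
      linarith
    subst hlm
    have hγ0 : γ = 0 := by
      ext j
      have h1 := hγ j
      rw [show lowerCoeff lam 0 = 0 by simp [lowerCoeff], mul_zero, Finsupp.single_zero,
        Finsupp.zero_apply, eq_comm] at h1
      refine (mul_eq_zero.1 h1).resolve_left ?_
      push_cast
      have : (0 : ℝ) ≤ j := Nat.cast_nonneg j
      linarith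
    refine ⟨rfl, A, b, ?_⟩
    have h0 : c₁ - b • upsilonEven = 0 := by
      refine cocycle_eq_zero (sub_mem hZ (Submodule.smul_mem _ _ (upsilonEven_mem_Z1 lam).2)) ?_ ?_
      · rw [LinearMap.sub_apply, hθ, LinearMap.smul_apply, upsilonEven_ospθ, smul_zero, sub_zero]
      · rw [LinearMap.sub_apply, hxθ, LinearMap.smul_apply, upsilonEven_ospxθ, hγ0, map_zero]
        simp
    rw [← sub_eq_zero.1 h0, ← hcc]
  · rw [Nat.add_sub_cancel] at hγ
    have hγs : γ = Finsupp.single m (γ m) := by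
      ext j
      by_cases hj : j = m
      · rw [hj, Finsupp.single_eq_same]
      · have h1 := hγ j
        rw [Finsupp.single_eq_of_ne hj] at h1 ⊢
        refine (mul_eq_zero.1 h1.symm).resolve_left fun h2 => hj ?_
        push_cast at h2
        have : (j : ℝ) = m := by linarith
        exact_mod_cast this
    rw [hγs, constSymbol_single] at hxθ
    -- At `j = m` the weight is exactly `½`, so the equation does not constrain `γ m` but forces
    -- this product to vanish.
    have hbq : b * lowerCoeff lam (m + 1) = 0 := by
      have h1 := hγ m
      rw [Finsupp.single_eq_same] at h1
      rw [h1]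
      push_cast
      ring
    by_cases hq : lowerCoeff lam (m + 1) = 0
    · right
      right
      -- For even degree the coefficient is `(m + 1)/4 > 0`.
      have hodd : ¬ Even (m + 1) := fun he => by
        rw [lowerCoeff, if_pos he] at hq
        push_cast at hq
        have : (0 : ℝ) ≤ m := Nat.cast_nonneg m
        linarith
      obtain ⟨i, hi⟩ := Nat.not_odd_iff_even.1 (fun h => hodd h.add_one)
      have hl : lam = (1 - ((i + 1 : ℕ) : ℝ)) / 2 := by
        rw [lowerCoeff, if_neg hodd, hi] at hq
        push_cast at hq ⊢
        linarith
      have hm : mu = ((i + 1 : ℕ) : ℝ) / 2 := by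
        rw [weight, hl, hi] at hn
        push_cast at hn ⊢
        linarith
      -- The sign of `b` comes from `Υ(X_{xθ}) = -θη̄²ᵏ⁻¹`.
      refine ⟨i + 1, by omega, hl, hm, A, -b, γ m, ?_⟩
      have h0 : c₁ - ((-b) • upsilonOdd (i + 1) + γ m • upsilonOddTilde (i + 1)) = 0 := by
        refine cocycle_eq_zero (sub_mem hZ (add_mem
          (Submodule.smul_mem _ _ (upsilonOdd_mem_Z1 (by omega) hl hm).2)
          (Submodule.smul_mem _ _ (upsilonOddTilde_mem_Z1 (by omega) hl hm).2))) ?_ ?_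
        · rw [LinearMap.sub_apply, hθ, LinearMap.add_apply, LinearMap.smul_apply,
            LinearMap.smul_apply, upsilonOdd_ospθ, upsilonOddTilde_ospθ]
          simp
        · rw [LinearMap.sub_apply, hxθ, LinearMap.add_apply, LinearMap.smul_apply,
            LinearMap.smul_apply, upsilonOdd_ospxθ, upsilonOddTilde_ospxθ, hi,
            show 2 * (i + 1) - 1 = i + i + 1 by omega, show 2 * (i + 1) - 2 = i + i by omega,
            mul_smul_comm, neg_smul, smul_neg, neg_neg, sub_self]
      rw [← sub_eq_zero.1 h0, ← hcc]
    · left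
      have hb : b = 0 := (mul_eq_zero.1 hbq).resolve_right hq
      rw [hb, zero_smul, mul_zero, zero_add] at hxθ
      -- Here `η̄ᵐ⁺¹` has weight zero, so `X_{xθ}` sends it to a nonzero multiple of `η̄ᵐ`; the
      -- minus sign is that of `delta0`.
      set B : DiffOp := (-(γ m / lowerCoeff lam (m + 1))) • dEtaBar ^ (m + 1) with hB
      refine ⟨A + B, ?_⟩
      have h0 : c₁ - (diffOpModule lam mu).delta0 B = 0 := by
        refine cocycle_eq_zero (sub_mem hZ ((diffOpModule lam mu).delta0_mem_totalZ1 B)) ?_ ?_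
        · rw [LinearMap.sub_apply, hθ, SuperModule.delta0_apply, act_eq_lieDiff, ospθ, hB, map_smul,
            lieDiff_sθ_pow, smul_zero, neg_zero, sub_zero]
        · rw [LinearMap.sub_apply, hxθ, SuperModule.delta0_apply, act_eq_lieDiff, ospxθ, hB,
            map_smul, lieDiff_sx_mul_sθ_pow, hn, zero_smul, zero_add, smul_smul, Nat.add_sub_cancel,
            neg_mul, div_mul_cancel₀ _ hq, neg_smul, neg_neg, sub_self]
      rw [map_add, ← sub_eq_zero.1 h0, ← hcc]

theorem cocycle_even_case {lam mu : ℝ} {c : osp12 →ₗ[ℝ] DiffOp}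
    (hc : c ∈ (diffOpModule lam mu).Z1 0) : c ∈ (diffOpModule lam mu).B1 0 ∨
      lam = mu ∧ ∃ b : ℝ, c - b • upsilonEven ∈ (diffOpModule lam mu).B1 0 := by
  rcases totalZ1_classification hc.2 with ⟨A, hA⟩ | ⟨rfl, A, b, hA⟩ | ⟨k, hk, hl, hm, A, b, b', hA⟩
  · left
    refine SuperModule.mem_B1_of_sub_mem_C1 _ hc.1 A ?_
    rw [hA, sub_self]
    exact zero_mem _
  · right
    refine ⟨rfl, b, SuperModule.mem_B1_of_sub_mem_C1 _
      (sub_mem hc.1 (Submodule.smul_mem _ _ (upsilonEven_mem_Z1 lam).1)) A ?_⟩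
    rw [hA, add_sub_cancel_right, sub_self]
    exact zero_mem _
  · left
    refine SuperModule.mem_B1_of_sub_mem_C1 _ hc.1 A ?_
    -- The explicit cocycles here are odd and `c` is even, so they are absorbed by separating
    -- parities.
    rw [hA, add_sub_cancel_left, zero_add]
    exact add_mem (Submodule.smul_mem _ _ (upsilonOdd_mem_Z1 hk hl hm).1)
      (Submodule.smul_mem _ _ (upsilonOddTilde_mem_Z1 hk hl hm).1)

theorem cocycle_odd_case {lam mu : ℝ} {c : osp12 →ₗ[ℝ] DiffOp}
    (hc : c ∈ (diffOpModule lam mu).Z1 1) : c ∈ (diffOpModule lam mu).B1 1 ∨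
      ∃ k : ℕ, 1 ≤ k ∧ lam = (1 - (k : ℝ)) / 2 ∧ mu = (k : ℝ) / 2 ∧ ∃ b b' : ℝ,
        c - (b • upsilonOdd k + b' • upsilonOddTilde k) ∈ (diffOpModule lam mu).B1 1 := by
  rcases totalZ1_classification hc.2 with ⟨A, hA⟩ | ⟨rfl, A, b, hA⟩ | ⟨k, hk, hl, hm, A, b, b', hA⟩
  · left
    refine SuperModule.mem_B1_of_sub_mem_C1 _ hc.1 A ?_
    rw [hA, sub_self]
    exact zero_mem _
  · left
    refine SuperModule.mem_B1_of_sub_mem_C1 _ hc.1 A ?_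
    rw [hA, add_sub_cancel_left]
    exact Submodule.smul_mem _ _ (upsilonEven_mem_Z1 lam).1
  · right
    refine ⟨k, hk, hl, hm, b, b', SuperModule.mem_B1_of_sub_mem_C1 _
      (sub_mem hc.1 (add_mem (Submodule.smul_mem _ _ (upsilonOdd_mem_Z1 hk hl hm).1)
        (Submodule.smul_mem _ _ (upsilonOddTilde_mem_Z1 hk hl hm).1))) A ?_⟩
    rw [hA, add_sub_cancel_right, sub_self]
    exact zero_mem _

/-! ### Independence of the classes and bases of the cohomology. -/

theorem upsilonEven_independent {lam a : ℝ}
    (h : a • upsilonEven ∈ (diffOpModule lam lam).B1 0) : a = 0 := by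
  obtain ⟨A, -, hA⟩ := h
  have h1 := LinearMap.congr_fun hA ospθ
  rw [LinearMap.smul_apply, upsilonEven_ospθ, smul_zero, SuperModule.delta0_apply, act_eq_lieDiff,
    ospθ, neg_eq_zero] at h1
  obtain ⟨α, rfl⟩ := exists_constSymbol_of_lieDiff_sθ_eq_zero h1
  have h2 := LinearMap.congr_fun hA ospx
  rw [LinearMap.smul_apply, upsilonEven_ospx, SuperModule.delta0_apply, act_eq_lieDiff, ospx,
    lieDiff_sx_constSymbol, ← map_neg, ← pow_zero dEtaBar, ← constSymbol_single] at h2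
  -- The degree zero coefficient of `X_x · A` vanishes, because `1` has weight zero when `λ = μ`.
  simpa [weight] using (DFunLike.congr_fun (constSymbol_injective h2) 0).symm

theorem upsilonOdd_independent {k : ℕ} {lam mu a a' : ℝ} (hk : 1 ≤ k)
    (hl : lam = (1 - (k : ℝ)) / 2) (hm : mu = (k : ℝ) / 2)
    (h : a • upsilonOdd k + a' • upsilonOddTilde k ∈ (diffOpModule lam mu).B1 1) :
    a = 0 ∧ a' = 0 := by
  obtain ⟨A, -, hA⟩ := h
  have hw : ∀ j, weight lam mu j = ((2 * k - 1 : ℕ) - j) / 2 := fun j => by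
    rw [weight, hl, hm, Nat.cast_sub (by omega)]
    push_cast
    ring
  have h1 := LinearMap.congr_fun hA ospθ
  rw [LinearMap.add_apply, LinearMap.smul_apply, LinearMap.smul_apply, upsilonOdd_ospθ,
    upsilonOddTilde_ospθ, smul_zero, smul_zero, add_zero, SuperModule.delta0_apply,
    act_eq_lieDiff, ospθ, neg_eq_zero] at h1
  obtain ⟨α, rfl⟩ := exists_constSymbol_of_lieDiff_sθ_eq_zero h1
  have h2 := LinearMap.congr_fun hA ospx
  rw [LinearMap.add_apply, LinearMap.smul_apply, LinearMap.smul_apply, upsilonOdd_ospx,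
    upsilonOddTilde_ospx, smul_zero, add_zero, SuperModule.delta0_apply, act_eq_lieDiff, ospx,
    lieDiff_sx_constSymbol, smul_neg, neg_inj, ← constSymbol_single] at h2
  have h3 := DFunLike.congr_fun (constSymbol_injective h2)
  -- The value at `X_x` of a coboundary vanishing at `X_θ` has no component of weight zero.
  have ha : a = 0 := by simpa [hw] using (h3 (2 * k - 1)).symm
  refine ⟨ha, ?_⟩
  have hα : α = Finsupp.single (2 * k - 1) (α (2 * k - 1)) := by
    ext j
    by_cases hj : j = 2 * k - 1
    · rw [hj, Finsupp.single_eq_same]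
    · have h4 := h3 j
      rw [ha, Finsupp.single_zero, Finsupp.zero_apply, Finsupp.coe_pointwise_smul, Pi.smul_apply',
        hw, smul_eq_mul] at h4
      rw [Finsupp.single_eq_of_ne hj]
      refine (mul_eq_zero.1 h4).resolve_left fun h5 => hj ?_
      have h6 : ((2 * k - 1 : ℕ) : ℝ) = j := by linarith
      exact_mod_cast h6.symm
  -- What is left of `A` is a multiple of the invariant `η̄²ᵏ⁻¹`, whose coboundary vanishes at
  -- `X_{xθ}`, where `Υ̃` does not.
  have hinv := isInvariant_pow hk hl hm (sx * sθ) ospxθ.2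
  have h4 := LinearMap.congr_fun hA ospxθ
  rw [LinearMap.add_apply, LinearMap.smul_apply, LinearMap.smul_apply, upsilonOddTilde_ospxθ, ha,
    zero_smul, zero_add, SuperModule.delta0_apply, act_eq_lieDiff, ospxθ, hα, constSymbol_single,
    map_smul, hinv, smul_zero, neg_zero, ← constSymbol_single, ← map_zero constSymbol] at h4
  exact Finsupp.single_eq_zero.1 (constSymbol_injective h4).symm

theorem exists_basis_H1_even (lam : ℝ) :
    ∃ b : Module.Basis (Fin 1) ℝ ((diffOpModule lam lam).H1 0),
      b 0 = (diffOpModule lam lam).cohClass upsilonEven (upsilonEven_mem_Z1 lam) := by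
  have hli : ∀ a : Fin 1 → ℝ,
      ∑ i, a i • upsilonEven ∈ (diffOpModule lam lam).B1 0 → a = 0 := fun a ha => by
    rw [Fin.sum_univ_one] at ha
    ext i
    rw [Subsingleton.elim i 0]
    exact upsilonEven_independent ha
  have hsp : ∀ c ∈ (diffOpModule lam lam).Z1 0, ∃ a : Fin 1 → ℝ,
      c - ∑ i, a i • upsilonEven ∈ (diffOpModule lam lam).B1 0 := fun c hc => by
    rcases cocycle_even_case hc with h | ⟨-, r, h⟩
    · exact ⟨0, by simpa using h⟩
    · exact ⟨fun _ => r, by rwa [Fin.sum_univ_one]⟩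
  obtain ⟨b, hb⟩ := (diffOpModule lam lam).exists_basis_H1 (fun _ : Fin 1 => upsilonEven)
    (fun _ => upsilonEven_mem_Z1 lam) hli hsp
  exact ⟨b, hb 0⟩

theorem exists_basis_H1_odd {k : ℕ} {lam mu : ℝ} (hk : 1 ≤ k) (hl : lam = (1 - (k : ℝ)) / 2)
    (hm : mu = (k : ℝ) / 2) :
    ∃ b : Module.Basis (Fin 2) ℝ ((diffOpModule lam mu).H1 1),
      b 0 = (diffOpModule lam mu).cohClass (upsilonOdd k) (upsilonOdd_mem_Z1 hk hl hm) ∧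
      b 1 = (diffOpModule lam mu).cohClass (upsilonOddTilde k)
        (upsilonOddTilde_mem_Z1 hk hl hm) := by
  have hli : ∀ a : Fin 2 → ℝ, ∑ i, a i • ![upsilonOdd k, upsilonOddTilde k] i ∈
      (diffOpModule lam mu).B1 1 → a = 0 := fun a ha => by
    rw [Fin.sum_univ_two] at ha
    obtain ⟨h0, h1⟩ := upsilonOdd_independent hk hl hm ha
    ext i
    fin_cases i
    · exact h0
    · exact h1
  have hsp : ∀ c ∈ (diffOpModule lam mu).Z1 1, ∃ a : Fin 2 → ℝ,
      c - ∑ i, a i • ![upsilonOdd k, upsilonOddTilde k] i ∈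
        (diffOpModule lam mu).B1 1 := fun c hc => by
    rcases cocycle_odd_case hc with h | ⟨k', -, -, hm', r, r', h⟩
    · exact ⟨0, by simpa using h⟩
    -- The integer is determined by `μ = k/2`.
    · have hkk : k' = k := by
        have : (k' : ℝ) = k := by linarith
        exact_mod_cast this
      subst hkk
      exact ⟨![r, r'], by rw [Fin.sum_univ_two]; exact h⟩
  obtain ⟨b, hb⟩ := (diffOpModule lam mu).exists_basis_H1 ![upsilonOdd k, upsilonOddTilde k]
    (Fin.forall_fin_two.2 ⟨upsilonOdd_mem_Z1 hk hl hm, upsilonOddTilde_mem_Z1 hk hl hm⟩) hli hsp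
  exact ⟨b, hb 0, hb 1⟩

end OspCohomology

end

open OspCohomology
theorem theorem1 :
    (∀ (lam mu : ℝ) (p : ZMod 2), Module.Finite ℝ ((diffOpModule lam mu).H1 p)) ∧
    (∀ lam : ℝ, Nonempty ((diffOpModule lam lam).H1 0 ≃ₗ[ℝ] ℝ) ∧
      ∃ (h : upsilonEven ∈ (diffOpModule lam lam).Z1 0)
        (b : Module.Basis (Fin 1) ℝ ((diffOpModule lam lam).H1 0)),
        b 0 = (diffOpModule lam lam).cohClass upsilonEven h) ∧
    (∀ lam mu : ℝ, lam ≠ mu → Subsingleton ((diffOpModule lam mu).H1 0)) ∧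
    (∀ (k : ℕ) (lam mu : ℝ), 1 ≤ k → lam = (1 - (k : ℝ)) / 2 → mu = (k : ℝ) / 2 →
      Nonempty ((diffOpModule lam mu).H1 1 ≃ₗ[ℝ] (Fin 2 → ℝ)) ∧
      ∃ (h : upsilonOdd k ∈ (diffOpModule lam mu).Z1 1)
        (h' : upsilonOddTilde k ∈ (diffOpModule lam mu).Z1 1)
        (b : Module.Basis (Fin 2) ℝ ((diffOpModule lam mu).H1 1)),
        b 0 = (diffOpModule lam mu).cohClass (upsilonOdd k) h ∧
        b 1 = (diffOpModule lam mu).cohClass (upsilonOddTilde k) h') ∧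
    (∀ lam mu : ℝ,
      (¬ ∃ k : ℕ, 1 ≤ k ∧ lam = (1 - (k : ℝ)) / 2 ∧ mu = (k : ℝ) / 2) →
      Subsingleton ((diffOpModule lam mu).H1 1)) := by
  have hs0 : ∀ lam mu : ℝ, lam ≠ mu → Subsingleton ((diffOpModule lam mu).H1 0) :=
    fun lam mu h => SuperModule.H1_subsingleton_of_le _ fun c hc =>
      (cocycle_even_case hc).resolve_right fun h' => h h'.1
  have hs1 : ∀ lam mu : ℝ,
      (¬ ∃ k : ℕ, 1 ≤ k ∧ lam = (1 - (k : ℝ)) / 2 ∧ mu = (k : ℝ) / 2) →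
      Subsingleton ((diffOpModule lam mu).H1 1) :=
    fun lam mu h => SuperModule.H1_subsingleton_of_le _ fun c hc =>
      (cocycle_odd_case hc).resolve_right fun ⟨k, hk, hl, hm, _⟩ => h ⟨k, hk, hl, hm⟩
  refine ⟨fun lam mu p => ?_, fun lam => ?_, hs0, fun k lam mu hk hl hm => ?_, hs1⟩
  · rcases parity_cases p with rfl | rfl
    · by_cases h : lam = mu
      · subst h
        obtain ⟨b, -⟩ := exists_basis_H1_even lam
        exact Module.Finite.of_basis b
      · have := hs0 lam mu h
        exact Module.Finite.of_basis (Module.Basis.empty (ι := Fin 0) _)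
    · by_cases h : ∃ k : ℕ, 1 ≤ k ∧ lam = (1 - (k : ℝ)) / 2 ∧ mu = (k : ℝ) / 2
      · obtain ⟨k, hk, hl, hm⟩ := h
        obtain ⟨b, -⟩ := exists_basis_H1_odd hk hl hm
        exact Module.Finite.of_basis b
      · have := hs1 lam mu h
        exact Module.Finite.of_basis (Module.Basis.empty (ι := Fin 0) _)
  · obtain ⟨b, hb⟩ := exists_basis_H1_even lam
    exact ⟨⟨b.equivFun.trans (LinearEquiv.funUnique (Fin 1) ℝ ℝ)⟩, upsilonEven_mem_Z1 lam, b, hb⟩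
  · obtain ⟨b, hb, hb'⟩ := exists_basis_H1_odd hk hl hm
    exact ⟨⟨b.equivFun⟩, upsilonOdd_mem_Z1 hk hl hm, upsilonOddTilde_mem_Z1 hk hl hm, b, hb, hb'⟩
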